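/- All measures are nonnegative Borel measures on $\mathbb{C}$, and $B(z,r)$ is the open disc with centre $z$ and radius $r>0$. Write $K(z)=1/z$ for $z\neq 0$ and, for $\delta>0$, $K_\delta(z)=\bar z/\max(\delta,|z|)^2$. A measure $\mu$ is \emph{$C_0$-good} if $\mu(B(z,r))\le C_0 r$ for every disc $B(z,r)$ (i.e. $\mu$ is \emph{$C_0$-nice}) and, for every $\delta>0$ and $f\in L^2(\mu)$, the function $\mathcal{C}_{\mu,\delta}(f)(z)=\int_{\mathbb{C}} K_\delta(z-\xi)f(\xi)\,d\mu(\xi)$ satisfies $\|\mathcal{C}_{\mu,\delta}(f)\|_{L^2(\mu)}\le C_0\|f\|_{L^2(\mu)}$. A nice measure $\mu$ is \emph{AD-regular} with constant $c_0>0$ if $\mu(B(z,r))\ge c_0 r$ for all $z\in\operatorname{supp}(\mu)$ and $r>0$. Let $\operatorname{Lip}_0(\mathbb{C})$ be the space of compactly supported Lipschitz functions $\mathbb{C}\to\mathbb{C}$. For a nice measure $\mu$ and $f,g\in\operatorname{Lip}_0(\mathbb{C})$ put $$\langle \mathcal{C}_\mu(f),g\rangle_\mu=\iint_{\mathbb{C}\times\mathbb{C}}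 K(z-\xi)\cdot\tfrac12\bigl[f(\xi)g(z)-f(z)g(\xi)\bigr]\,d\mu(z)\,d\mu(\xi).$$ For $z_0\notin\operatorname{supp}(\mu)$, $\psi\in\operatorname{Lip}_0(\mathbb{C})$, and $\varphi\in\operatorname{Lip}_0(\mathbb{C})$ with $\varphi\equiv1$ on a neighbourhood of $\operatorname{supp}(\psi)$, put $$\langle\widetilde{\mathcal{C}}_\mu(1),\psi\rangle_\mu=\langle\mathcal{C}_\mu(\varphi),\psi\rangle_\mu-\int_{\mathbb{C}} K(z_0-\xi)\varphi(\xi)\,d\mu(\xi)\cdot\int_{\mathbb{C}}\psi\,d\mu+\int_{\mathbb{C}}\psi(z)\int_{\mathbb{C}}(1-\varphi(\xi))\bigl[K(z-\xi)-K(z_0-\xi)\bigr]\,d\mu(\xi)\,d\mu(z);$$ this does not depend on the choice of $\varphi$, nor, when $\int\psi\,d\mu=0$, on the choice of $z_0$. The measure $\mu$ is \emph{reflectionless} if $\operatorname{supp}(\mu)\neq\mathbb{C}$ and $\langle\widetilde{\mathcal{C}}_\mu(1),\psi\rangle_\mu=0$ for every compactly supported $\psi:\mathbb{C}\to\mathbb{C}$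 with Lipschitz constant at most $1$ and $\int_{\mathbb{C}}\psi\,d\mu=0$. \textbf{Lemma.} Let $\mu$ be a reflectionless measure that is $C_0$-good and AD-regular with constant $c_0$, for some $C_0$ and some $c_0>0$. Let $z\notin\operatorname{supp}(\mu)$, let $\tilde z\in\operatorname{supp}(\mu)$ be a closest point of $\operatorname{supp}(\mu)$ to $z$, and set $e=\dfrac{\tilde z-z}{|\tilde z-z|}$. Then $\operatorname{supp}(\mu)\subset H_{\tilde z,e}$, where $H_{\tilde z,e}=\{w\in\mathbb{C}:\langle w-\tilde z,e\rangle\ge0\}$ is the closed half-plane with $\tilde z$ on its boundary and inner unit normal $e$ (here $\langle\cdot,\cdot\rangle$ is the standard inner product of $\mathbb{R}^2$). -/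

import Mathlib

open MeasureTheory Filter Topology

noncomputable section

namespace CauchyTransform

/-- The Cauchy kernel `K(z) = 1/z` (used only off the origin). -/
def kernel (z : ℂ) : ℂ := 1 / z

/-- The regularized Cauchy kernel `K_δ(z) = conj z / max(δ, |z|)²`. -/
def regKernel (δ : ℝ) (z : ℂ) : ℂ := (starRingEnd ℂ) z / ((max δ ‖z‖ : ℝ) : ℂ) ^ 2

/-- The regularized Cauchy transform
`C_{μ,δ}(f)(z) = ∫ K_δ(z - ξ) f(ξ) dμ(ξ)`. -/
def regTransform (μ : Measure ℂ) (δ : ℝ) (f : ℂ → ℂ) (z : ℂ) : ℂ :=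
  ∫ ξ, regKernel δ (z - ξ) * f ξ ∂μ

/-- `μ` is `C₀`-nice: `μ(B(z,r)) ≤ C₀ r` for every open disc `B(z,r)`. -/
def IsNice (C₀ : ℝ) (μ : Measure ℂ) : Prop :=
  ∀ (z : ℂ) (r : ℝ), 0 < r → μ (Metric.ball z r) ≤ ENNReal.ofReal (C₀ * r)

/-- `μ` is `C₀`-good: it is `C₀`-nice and
`sup_{δ > 0} ‖C_{μ,δ}‖_{L²(μ) → L²(μ)} ≤ C₀`. -/
def IsGood (C₀ : ℝ) (μ : Measure ℂ) : Prop :=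
  IsNice C₀ μ ∧ ∀ δ : ℝ, 0 < δ → ∀ f : ℂ → ℂ, MemLp f 2 μ →
    eLpNorm (regTransform μ δ f) 2 μ ≤ ENNReal.ofReal C₀ * eLpNorm f 2 μ

/-- A nice measure `μ` is AD-regular with regularity constant `c₀ > 0`:
`μ(B(z,r)) ≥ c₀ r` for every disc centred on `supp μ`. -/
def IsADRegular (c₀ : ℝ) (μ : Measure ℂ) : Prop :=
  (∃ C₀ : ℝ, IsNice C₀ μ) ∧ 0 < c₀ ∧
    ∀ z ∈ μ.support, ∀ r : ℝ, 0 < r → ENNReal.ofReal (c₀ * r) ≤ μ (Metric.ball z r)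

/-- `Lip₀(ℂ)`: compactly supported functions with finite Lipschitz norm. -/
def IsLipZero (f : ℂ → ℂ) : Prop :=
  (∃ L : NNReal, LipschitzWith L f) ∧ HasCompactSupport f

/-- The pairing `⟨C_μ(f), g⟩_μ` for `f, g ∈ Lip₀(ℂ)`, that is the absolutely convergent
double integral `∬ K(z - ξ) · ½ [f(ξ) g(z) - f(z) g(ξ)] dμ(z) dμ(ξ)`. -/
def pairing (μ : Measure ℂ) (f g : ℂ → ℂ) : ℂ :=
  ∫ p : ℂ × ℂ, kernel (p.1 - p.2) * ((1 / 2) * (f p.2 * g p.1 - f p.1 * g p.2)) ∂(μ.prod μ)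

/-- The expression defining the pairing `⟨C̃_μ(1), ψ⟩_μ`, with base point `z₀ ∉ supp μ` and a
cutoff `φ ∈ Lip₀(ℂ)` that is `1` on a neighbourhood of `supp ψ`. The second term contains
`C_μ(φ)(z₀) = ∫ K(z₀ - ξ) φ(ξ) dμ(ξ)`. -/
def tildePairing (μ : Measure ℂ) (z₀ : ℂ) (φ ψ : ℂ → ℂ) : ℂ :=
  pairing μ φ ψ - (∫ ξ, kernel (z₀ - ξ) * φ ξ ∂μ) * (∫ z, ψ z ∂μ)
    + ∫ z, ψ z * (∫ ξ, (1 - φ ξ) * (kernel (z - ξ) - kernel (z₀ - ξ)) ∂μ) ∂μ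

/-- The class `Φ^μ` of compactly supported `ψ` with `‖ψ‖_Lip ≤ 1` and `∫ ψ dμ = 0`. -/
def MeanZeroLip (μ : Measure ℂ) : Set (ℂ → ℂ) :=
  {ψ | LipschitzWith 1 ψ ∧ HasCompactSupport ψ ∧ ∫ z, ψ z ∂μ = 0}

/-- `μ` is reflectionless: `⟨C̃_μ(1), ψ⟩_μ = 0` for all `ψ ∈ Φ^μ`. For `ψ` of mean zero the
value depends neither on the base point `z₀ ∉ supp μ` nor on the cutoff `φ`. -/
def IsReflectionless (μ : Measure ℂ) : Prop :=
  ∃ z₀ ∉ μ.support, ∀ ψ ∈ MeanZeroLip μ, ∀ φ : ℂ → ℂ, IsLipZero φ →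
    (∀ᶠ ξ in 𝓝ˢ (tsupport ψ), φ ξ = 1) → tildePairing μ z₀ φ ψ = 0

/-- The closed half-plane with `z` on its boundary and inner unit normal `e`. -/
def halfPlane (z e : ℂ) : Set ℂ := {w | 0 ≤ inner ℝ (w - z) e}

end CauchyTransform

end

/-! The support of `μ` turns out to be a straight line, so a nearest point is a foot of a
perpendicular and the support lies on the boundary of the half-plane. Reflectionlessness says weakly
that the Cauchy transform of `1` is constant on the support: after symmetrization, `⟨C̃_μ(1), ψ⟩ = α
∫ ψ dμ` for every `ψ` in `Lip₀` (`exists_integral_symIntegrand_eq`). Let `F(z) = ∫ [K(z - w) - K(z₀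
- w)] dμ(w)`. Testing, through cutoffs, with `ψ = K(z - ·) - K(z₀ - ·)` for `z` off the support,
partial fractions turn the symmetrized integrand into `½ ψ(x) ψ(w)`. Hence `½ F(z)² = α F(z)`, and
`F` takes only the values `0` and `2α` there (`modTransform_sq`). AD-regularity makes the support
null for area, so these values determine `F` almost everywhere. By Cauchy–Pompeiu, `∂̄F = π μ` as
distributions, so `α ≠ 0`, and `u = F / (2α)` agrees a.e. with an indicator whose gradient is `b μ`
for the constant vector `b = π / α` (`exists_isHalfIndicator`). Since `μ ≥ 0`, `u` increases in the
direction `b` and is invariant orthogonally to it, while near each point of the support it takes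
both values. Therefore all points of the support have the same `b`-coordinate (`inner_sub_eq_zero`),
and the support is invariant under translations orthogonal to `b` (`add_mem_support`). -/

noncomputable section

namespace CauchyTransform

variable {μ : Measure ℂ} {C₀ c₀ : ℝ}

/-! ### Decay weights integrable against measures of linear growth -/

/-- The radial weight `(1 + t)^(-3/2)`. -/
def decay (t : ℝ) : ℝ := (1 + t) ^ (-(3 / 2) : ℝ)

lemma continuousOn_decay : ContinuousOn decay (Set.Ici 0) := by
  intro t ht
  have ht : 0 ≤ t := ht
  exact ((continuousAt_const.add continuousAt_id).rpow_const
    (Or.inl (by simp; linarith))).continuousWithinAt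

lemma continuous_decay_norm {E : Type*} [SeminormedAddCommGroup E] :
    Continuous fun w : E => decay ‖w‖ :=
  continuousOn_decay.comp_continuous continuous_norm fun w => norm_nonneg w

lemma decay_nonneg {t : ℝ} (ht : 0 ≤ t) : 0 ≤ decay t := Real.rpow_nonneg (by linarith) _

lemma inv_sq_le_decay {t : ℝ} (ht : 0 ≤ t) : ((1 + t) ^ 2)⁻¹ ≤ decay t := by
  rw [decay, ← Real.rpow_natCast, ← Real.rpow_neg (by linarith)]
  exact Real.rpow_le_rpow_of_exponent_le (by linarith) (by norm_num)

/-- Splitting a product of three weights into products that are integrable one variable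
at a time. -/
lemma inv_mul_three_le {a b d : ℝ} (ha : 0 ≤ a) (hb : 0 ≤ b) (hd : 0 ≤ d) (h : a ≤ b + d) :
    ((1 + a) * (1 + b) * (1 + d))⁻¹ ≤ 2 * (decay a * (decay b + decay d)) := by
  wlog hbd : b ≤ d generalizing b d
  · have := this hd hb (by linarith) (by linarith)
    rw [add_comm (decay b), show (1 + a) * (1 + b) * (1 + d) = (1 + a) * (1 + d) * (1 + b) by ring]
    exact this
  have h3 : ∀ t : ℝ, 0 ≤ t → decay t = (1 + t)⁻¹ * (√(1 + t))⁻¹ := by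
    intro t ht
    rw [decay, Real.sqrt_eq_rpow, ← Real.rpow_neg_one, ← Real.rpow_neg (by linarith),
      ← Real.rpow_add (by linarith)]
    norm_num
  -- From `a ≤ b + d ≤ 2d`, the factor `(1 + d)⁻¹` can be shared out as half a power for `a` and
  -- half a power for `b`.
  have hA : (√(1 + a))  ≤ 2 * √(1 + d) := by
    rw [Real.sqrt_le_left (by positivity), mul_pow, Real.sq_sqrt (by linarith)]
    linarith
  have hB : √(1 + b) ≤ √(1 + d) := Real.sqrt_le_sqrt (by linarith)
  have hsd : 0 < √(1 + d) := Real.sqrt_pos.2 (by linarith)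
  have hsa : 0 < √(1 + a) := Real.sqrt_pos.2 (by linarith)
  have hsb : 0 < √(1 + b) := Real.sqrt_pos.2 (by linarith)
  have key : ((1 + a) * (1 + b) * (1 + d))⁻¹ ≤ 2 * (decay a * decay b) := by
    rw [h3 a ha, h3 b hb]
    have : (1 + d)⁻¹ ≤ 2 * ((√(1 + a))⁻¹ * (√(1 + b))⁻¹) := by
      rw [← mul_inv, ← div_eq_mul_inv, le_div_iff₀ (by positivity), ← div_eq_inv_mul,
        div_le_iff₀ (by linarith)]
      calc _ ≤ 2 * √(1 + d) * √(1 + d) := by gcongr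
        _ = 2 * (1 + d) := by rw [mul_assoc, Real.mul_self_sqrt (by linarith)]
    calc ((1 + a) * (1 + b) * (1 + d))⁻¹ = (1 + a)⁻¹ * (1 + b)⁻¹ * (1 + d)⁻¹ := by
          rw [mul_inv, mul_inv]
      _ ≤ (1 + a)⁻¹ * (1 + b)⁻¹ * (2 * ((√(1 + a))⁻¹ * (√(1 + b))⁻¹)) := by gcongr
      _ = _ := by ring
  refine key.trans ?_
  have := decay_nonneg ha
  have := decay_nonneg hd
  gcongr
  linarith

lemma IsNice.abs (h : IsNice C₀ μ) : IsNice |C₀| μ := fun z r hr =>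
  (h z r hr).trans (ENNReal.ofReal_le_ofReal (by gcongr; exact le_abs_self _))

lemma IsNice.isLocallyFiniteMeasure (h : IsNice C₀ μ) : IsLocallyFiniteMeasure μ :=
  ⟨fun x => ⟨Metric.ball x 1, Metric.ball_mem_nhds x one_pos,
    (h x 1 one_pos).trans_lt ENNReal.ofReal_lt_top⟩⟩

lemma IsNice.nullSingletonClass (h : IsNice C₀ μ) : NullSingletonClass μ := by
  refine ⟨fun z => ?_⟩
  have h1 : Tendsto (fun r : ℝ => ENNReal.ofReal (C₀ * r)) (𝓝[>] 0) (𝓝 0) := by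
    have : Tendsto (fun r : ℝ => ENNReal.ofReal (C₀ * r)) (𝓝 0) (𝓝 (ENNReal.ofReal (C₀ * 0))) :=
      (ENNReal.continuous_ofReal.comp (continuous_const.mul continuous_id)).tendsto 0
    rw [mul_zero, ENNReal.ofReal_zero] at this
    exact this.mono_left nhdsWithin_le_nhds
  refine le_antisymm (ge_of_tendsto h1 ?_) bot_le
  filter_upwards [self_mem_nhdsWithin] with r hr
  exact (measure_mono (by simpa using hr)).trans (h z r hr)

/-- Linear growth gives the dyadic disc of radius `2^k` mass `O(2^k)`, while the weight is
`O(2^(-3k/2))` on its outer annulus: a geometric series, uniform in the centre. Uniformity is what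
allows the double integrals to be done one variable at a time. -/
lemma IsNice.lintegral_decay_le (h : IsNice C₀ μ) :
    ∃ M : ENNReal, M ≠ ⊤ ∧ ∀ z, ∫⁻ w, ENNReal.ofReal (decay ‖z - w‖) ∂μ ≤ M := by
  set a : ℕ → ℝ := fun k => (2 ^ k / 2 : ℝ) ^ (-(3 / 2) : ℝ) with ha
  set r : ℝ := (2 : ℝ) ^ (-(1 / 2) : ℝ) with hr
  have hr1 : r < 1 := Real.rpow_lt_one_of_one_lt_of_neg (by norm_num) (by norm_num)
  have hr0 : 0 ≤ r := by positivity
  have hak : ∀ k, a k * (|C₀| * 2 ^ k) = |C₀| * (2 : ℝ) ^ (3 / 2 : ℝ) * r ^ k := by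
    intro k
    have h1 : (2 ^ k : ℝ) ^ (-(3 / 2) : ℝ) * 2 ^ k = r ^ k := by
      nth_rewrite 2 [← Real.rpow_one (2 ^ k : ℝ)]
      rw [← Real.rpow_add (by positivity), hr, ← Real.rpow_natCast, ← Real.rpow_natCast,
        ← Real.rpow_mul (by norm_num), ← Real.rpow_mul (by norm_num)]
      congr 1; ring
    rw [ha]
    simp only
    rw [Real.div_rpow (by positivity) (by norm_num), Real.rpow_neg (by norm_num : (0:ℝ) ≤ 2),
      div_inv_eq_mul, ← h1]
    ring
  refine ⟨∑' k : ℕ, ENNReal.ofReal (|C₀| * (2 : ℝ) ^ (3 / 2 : ℝ) * r ^ k), ?_, fun z => ?_⟩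
  · rw [← ENNReal.ofReal_tsum_of_nonneg (fun k => by positivity)
      ((summable_geometric_of_lt_one hr0 hr1).mul_left _)]
    exact ENNReal.ofReal_ne_top
  · calc ∫⁻ w, ENNReal.ofReal (decay ‖z - w‖) ∂μ
        ≤ ∫⁻ w, ∑' k : ℕ, (Metric.ball z (2 ^ k)).indicator
            (fun _ => ENNReal.ofReal (a k)) w ∂μ := by
          refine lintegral_mono fun w => ?_
          have hex : ∃ k : ℕ, ‖z - w‖ < 2 ^ k := pow_unbounded_of_one_lt _ (by norm_num)
          refine le_trans ?_ (ENNReal.le_tsum (Nat.find hex))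
          have hk := Nat.find_spec hex
          rw [Set.indicator_of_mem (by rwa [Metric.mem_ball', dist_eq_norm])]
          -- For the least admissible `k`, `1 + ‖z - w‖ ≥ 2^k / 2`; when `k = 0` the summand `1`
          -- alone ensures this.
          refine ENNReal.ofReal_le_ofReal (Real.rpow_le_rpow_of_nonpos (by positivity) ?_
            (by norm_num))
          rcases hn : Nat.find hex with _ | n
          · have := norm_nonneg (z - w); norm_num; linarith
          · have := Nat.find_min hex (m := n) (by omega)
            rw [not_lt] at this
            rw [pow_succ]; linarith
      _ = ∑' k : ℕ, ENNReal.ofReal (a k) * μ (Metric.ball z (2 ^ k)) := by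
          rw [lintegral_tsum fun k => (measurable_const.indicator measurableSet_ball).aemeasurable]
          congr 1; ext k
          rw [lintegral_indicator_const measurableSet_ball]
      _ ≤ _ := by
          refine ENNReal.tsum_le_tsum fun k => ?_
          rw [← hak, ENNReal.ofReal_mul (by positivity)]
          gcongr
          exact h.abs z _ (by positivity)

lemma IsNice.integrable_decay (h : IsNice C₀ μ) (z : ℂ) :
    Integrable (fun w => decay ‖z - w‖) μ := by
  obtain ⟨M, hM, hz⟩ := h.lintegral_decay_le
  refine ⟨(continuous_decay_norm.comp (continuous_const.sub continuous_id)).aestronglyMeasurable,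
    ?_⟩
  rw [hasFiniteIntegral_iff_ofReal (Eventually.of_forall fun w => decay_nonneg (norm_nonneg _))]
  exact (hz z).trans_lt hM.lt_top

lemma IsNice.integrable_decay_norm (h : IsNice C₀ μ) : Integrable (fun w => decay ‖w‖) μ := by
  simpa using h.integrable_decay 0

lemma IsNice.integrable_decay_mul_decay_sub (h : IsNice C₀ μ) :
    Integrable (fun p : ℂ × ℂ => decay ‖p.1‖ * decay ‖p.1 - p.2‖) (μ.prod μ) := by
  have := h.isLocallyFiniteMeasure
  obtain ⟨M, hM, hz⟩ := h.lintegral_decay_le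
  have hc : Continuous (fun p : ℂ × ℂ => decay ‖p.1‖ * decay ‖p.1 - p.2‖) :=
    (continuous_decay_norm.comp continuous_fst).mul
      (continuous_decay_norm.comp (continuous_fst.sub continuous_snd))
  refine ⟨hc.aestronglyMeasurable, ?_⟩
  rw [hasFiniteIntegral_iff_ofReal (Eventually.of_forall fun w =>
    mul_nonneg (decay_nonneg (norm_nonneg _)) (decay_nonneg (norm_nonneg _)))]
  rw [lintegral_prod _ hc.measurable.ennreal_ofReal.aemeasurable]
  calc _ ≤ ∫⁻ x, ENNReal.ofReal (decay ‖x‖) * M ∂μ := by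
        refine lintegral_mono fun x => ?_
        simp_rw [ENNReal.ofReal_mul (decay_nonneg (norm_nonneg x))]
        rw [lintegral_const_mul' _ _ ENNReal.ofReal_ne_top]
        gcongr
        exact hz x
    _ = (∫⁻ x, ENNReal.ofReal (decay ‖x‖) ∂μ) * M := lintegral_mul_const' _ _ hM
    _ < ⊤ := by
        refine ENNReal.mul_lt_top (lt_of_le_of_lt ?_ hM.lt_top) hM.lt_top
        simpa using hz 0

lemma IsNice.integrable_decay_mul_decay (h : IsNice C₀ μ) :
    Integrable (fun p : ℂ × ℂ => decay ‖p.1‖ * decay ‖p.2‖) (μ.prod μ) := by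
  have := h.isLocallyFiniteMeasure
  exact h.integrable_decay_norm.mul_prod h.integrable_decay_norm

/-! ### Bounds for the Cauchy kernel off the support -/

lemma ae_mem_support (μ : Measure ℂ) : ∀ᵐ w ∂μ, w ∈ μ.support := Measure.support_mem_ae

lemma measurable_kernel : Measurable kernel := by
  unfold kernel; fun_prop

lemma norm_kernel (w : ℂ) : ‖kernel w‖ = ‖w‖⁻¹ := by simp [kernel]

lemma exists_norm_kernel_sub_le {z : ℂ} (hz : z ∉ μ.support) :
    ∃ C : ℝ, 0 < C ∧ ∀ w ∈ μ.support, ‖kernel (z - w)‖ ≤ C * (1 + ‖w‖)⁻¹ := by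
  obtain ⟨d, hd, hball⟩ := Metric.isOpen_iff.1 Measure.isOpen_compl_support z hz
  refine ⟨(1 + ‖z‖) / d + 1, by positivity, fun w hw => ?_⟩
  have hdw : d ≤ ‖z - w‖ := by
    by_contra hlt
    exact hball (by rwa [Metric.mem_ball', dist_eq_norm, ← not_le]) hw
  have h0 : 0 < ‖z - w‖ := hd.trans_le hdw
  rw [norm_kernel, ← div_eq_mul_inv, le_div_iff₀ (by positivity), ← div_eq_inv_mul,
    div_le_iff₀ h0, add_mul, one_mul]
  have h1 : ‖w‖ ≤ ‖z‖ + ‖z - w‖ := by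
    have := norm_sub_le z (z - w); simpa using this
  have h2 : 1 + ‖z‖ ≤ (1 + ‖z‖) / d * ‖z - w‖ := by
    rw [div_mul_eq_mul_div, le_div_iff₀ hd]
    gcongr
  linarith

/-- The difference `K(z - w) - K(z₀ - w)`. -/
def kernelDiff (z₀ z w : ℂ) : ℂ := kernel (z - w) - kernel (z₀ - w)

lemma measurable_kernelDiff (z₀ z : ℂ) : Measurable (kernelDiff z₀ z) := by
  unfold kernelDiff
  exact (measurable_kernel.comp (by fun_prop)).sub (measurable_kernel.comp (by fun_prop))

lemma kernelDiff_eq {z₀ z w : ℂ} (h0 : w ≠ z₀) (h : w ≠ z) :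
    kernelDiff z₀ z w = (z₀ - z) * kernel (z - w) * kernel (z₀ - w) := by
  have h1 : z - w ≠ 0 := sub_ne_zero.2 h.symm
  have h2 : z₀ - w ≠ 0 := sub_ne_zero.2 h0.symm
  simp only [kernelDiff, kernel]
  field_simp
  ring

/-- Subtracting the base point improves the decay from order one, which need not be integrable under
linear growth, to order two. -/
lemma exists_norm_kernelDiff_le {z₀ z : ℂ} (hz₀ : z₀ ∉ μ.support) (hz : z ∉ μ.support) :
    ∃ C : ℝ, 0 < C ∧ ∀ w ∈ μ.support, ‖kernelDiff z₀ z w‖ ≤ C * decay ‖w‖ := by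
  obtain ⟨C, hC, h⟩ := exists_norm_kernel_sub_le hz
  obtain ⟨C', hC', h'⟩ := exists_norm_kernel_sub_le hz₀
  refine ⟨(‖z₀ - z‖ + 1) * C * C', by positivity, fun w hw => ?_⟩
  rw [kernelDiff_eq (by rintro rfl; exact hz₀ hw) (by rintro rfl; exact hz hw), norm_mul, norm_mul]
  calc ‖z₀ - z‖ * ‖kernel (z - w)‖ * ‖kernel (z₀ - w)‖
      ≤ (‖z₀ - z‖ + 1) * (C * (1 + ‖w‖)⁻¹) * (C' * (1 + ‖w‖)⁻¹) := by
        gcongr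
        · linarith
        · exact h w hw
        · exact h' w hw
    _ = (‖z₀ - z‖ + 1) * C * C' * ((1 + ‖w‖) ^ 2)⁻¹ := by rw [sq, mul_inv]; ring
    _ ≤ _ := by gcongr; exact inv_sq_le_decay (norm_nonneg w)

/-! ### The symmetrized, cutoff-free form of the pairing -/

/-- The modified Cauchy transform `∫ [K(z - w) - K(z₀ - w)] dμ(w)` of the constant `1`. -/
def modTransform (μ : Measure ℂ) (z₀ z : ℂ) : ℂ := ∫ w, kernelDiff z₀ z w ∂μ

/-- The integrand of the symmetrized form of `⟨C̃_μ(1), ψ⟩_μ`, which involves no cutoff. -/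
def symIntegrand (z₀ : ℂ) (ψ : ℂ → ℂ) (p : ℂ × ℂ) : ℂ :=
  (1 / 2) * (kernel (p.1 - p.2) * (ψ p.1 - ψ p.2) - kernel (z₀ - p.2) * ψ p.1
    - kernel (z₀ - p.1) * ψ p.2)

lemma IsLipZero.continuous {f : ℂ → ℂ} (hf : IsLipZero f) : Continuous f := by
  obtain ⟨⟨L, hL⟩, -⟩ := hf
  exact hL.continuous

lemma IsLipZero.exists_bound {f : ℂ → ℂ} (hf : IsLipZero f) : ∃ B : ℝ, 0 ≤ B ∧ ∀ w, ‖f w‖ ≤ B := by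
  obtain ⟨B, hB⟩ := hf.2.exists_bound_of_continuous hf.continuous
  exact ⟨B, (norm_nonneg _).trans (hB 0), hB⟩

lemma IsLipZero.exists_radius {f : ℂ → ℂ} (hf : IsLipZero f) :
    ∃ R : ℝ, 0 < R ∧ tsupport f ⊆ Metric.closedBall 0 R := by
  obtain ⟨R, hR⟩ := (hf.2 : IsCompact (tsupport f)).isBounded.subset_closedBall 0
  exact ⟨max R 1, by positivity, hR.trans (Metric.closedBall_subset_closedBall (le_max_left _ _))⟩

lemma IsLipZero.integrable {f : ℂ → ℂ} (hf : IsLipZero f) [IsLocallyFiniteMeasure μ] :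
    Integrable f μ :=
  hf.continuous.integrable_of_hasCompactSupport hf.2

lemma IsLipZero.add {f g : ℂ → ℂ} (hf : IsLipZero f) (hg : IsLipZero g) : IsLipZero (f + g) := by
  obtain ⟨⟨L, hL⟩, hf⟩ := hf
  obtain ⟨⟨L', hL'⟩, hg⟩ := hg
  exact ⟨⟨L + L', hL.add hL'⟩, hf.add hg⟩

lemma IsLipZero.const_smul {f : ℂ → ℂ} (hf : IsLipZero f) (c : ℂ) :
    IsLipZero (c • f) := by
  obtain ⟨⟨L, hL⟩, hf⟩ := hf
  refine ⟨⟨‖c‖₊ * L, ?_⟩, hf.smul_left⟩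
  exact (lipschitzWith_smul c).comp hL

lemma isLipZero_of_contDiff {f : ℂ → ℂ} (hf : ContDiff ℝ 1 f) (h : HasCompactSupport f) :
    IsLipZero f :=
  ⟨hf.lipschitzWith_of_hasCompactSupport h one_ne_zero, h⟩

/-- For every compact set there is a cutoff in `Lip₀(ℂ)` which is `1` near a large disc. -/
lemma exists_cutoff {R : ℝ} (hR : 0 < R) :
    ∃ φ : ℂ → ℂ, IsLipZero φ ∧ (∀ w, ‖w‖ ≤ R → φ w = 1) ∧ ∀ w, ‖1 - φ w‖ ≤ 1 := by
  let b : ContDiffBump (0 : ℂ) := ⟨R, R + 1, hR, by linarith⟩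
  refine ⟨fun w => (b w : ℂ), isLipZero_of_contDiff ?_ ?_, fun w hw => ?_, fun w => ?_⟩
  · exact Complex.ofRealCLM.contDiff.comp b.contDiff
  · exact b.hasCompactSupport.comp_left (g := fun x : ℝ => (x : ℂ)) Complex.ofReal_zero
  · have : b w = 1 := b.one_of_mem_closedBall (by simpa using hw)
    simp [this]
  · rw [← Complex.ofReal_one, ← Complex.ofReal_sub, Complex.norm_real, Real.norm_eq_abs, abs_le]
    have h0 := b.nonneg' w
    have h1 := b.le_one (x := w)
    constructor <;> linarith

lemma norm_kernel_mul_le {L : NNReal} {f : ℂ → ℂ} (hf : LipschitzWith L f) (x w : ℂ) :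
    ‖kernel (x - w) * (f x - f w)‖ ≤ L := by
  rcases eq_or_ne x w with rfl | h
  · simp
  · have h0 : 0 < ‖x - w‖ := norm_pos_iff.2 (sub_ne_zero.2 h)
    rw [norm_mul, norm_kernel, inv_mul_le_iff₀ h0, mul_comm]
    simpa [dist_eq_norm] using hf.dist_le_mul x w

lemma integrable_pairing_integrand [IsLocallyFiniteMeasure μ] {f g : ℂ → ℂ} (hf : IsLipZero f)
    (hg : IsLipZero g) : Integrable (fun p : ℂ × ℂ =>
      kernel (p.1 - p.2) * ((1 / 2) * (f p.2 * g p.1 - f p.1 * g p.2))) (μ.prod μ) := by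
  obtain ⟨R, hR, hfR⟩ := hf.exists_radius
  obtain ⟨R', hR', hgR⟩ := hg.exists_radius
  obtain ⟨B, hB, hfB⟩ := hf.exists_bound
  obtain ⟨B', hB', hgB⟩ := hg.exists_bound
  have hfc := hf.continuous
  have hgc := hg.continuous
  obtain ⟨⟨L, hL⟩, -⟩ := hf
  obtain ⟨⟨L', hL'⟩, -⟩ := hg
  set S : Set (ℂ × ℂ) := Metric.closedBall 0 (max R R') with hS
  have hSfin : (μ.prod μ) S < ⊤ := (isCompact_closedBall _ _).measure_lt_top
  have hm : Measurable (fun p : ℂ × ℂ =>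
      kernel (p.1 - p.2) * ((1 / 2) * (f p.2 * g p.1 - f p.1 * g p.2))) := by
    have := measurable_kernel
    fun_prop
  have hsupp : ∀ p ∉ S, kernel (p.1 - p.2) * ((1 / 2) * (f p.2 * g p.1 - f p.1 * g p.2)) = 0 := by
    intro p hp
    have hz : ∀ w : ℂ, max R R' < ‖w‖ → f w = 0 ∧ g w = 0 := by
      intro w hw
      refine ⟨image_eq_zero_of_notMem_tsupport fun h => ?_,
        image_eq_zero_of_notMem_tsupport fun h => ?_⟩
      · have := hfR h
        rw [mem_closedBall_zero_iff] at this
        exact absurd (lt_of_le_of_lt (le_max_left _ _) hw) (not_lt.2 this)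
      · have := hgR h
        rw [mem_closedBall_zero_iff] at this
        exact absurd (lt_of_le_of_lt (le_max_right _ _) hw) (not_lt.2 this)
    rw [hS, mem_closedBall_zero_iff, not_le, Prod.norm_def, lt_max_iff] at hp
    rcases hp with hp | hp
    · simp [hz _ hp]
    · simp [hz _ hp]
  rw [← integrableOn_iff_integrable_of_support_subset (s := S) (fun p hp => by
    by_contra h; exact hp (hsupp p h))]
  refine Measure.integrableOn_of_bounded (M := L' * B + L * B') hSfin.ne hm.aestronglyMeasurable
    (Eventually.of_forall fun p => ?_)
  -- Each kernel is paired with a Lipschitz difference, which cancels the singularity on the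
  -- diagonal.
  have e : kernel (p.1 - p.2) * ((1 / 2) * (f p.2 * g p.1 - f p.1 * g p.2)) = (1 / 2) *
      ((kernel (p.1 - p.2) * (g p.1 - g p.2)) * f p.2
        - (kernel (p.1 - p.2) * (f p.1 - f p.2)) * g p.2) := by ring
  rw [e, norm_mul]
  calc ‖(1 / 2 : ℂ)‖ * _ ≤ 1 * (L' * B + L * B') := by
        gcongr
        · norm_num
        · refine (norm_sub_le _ _).trans ?_
          rw [norm_mul _ (f p.2), norm_mul _ (g p.2)]
          have h1 := norm_kernel_mul_le hL' p.1 p.2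
          have h2 := norm_kernel_mul_le hL p.1 p.2
          exact add_le_add (mul_le_mul h1 (hfB _) (norm_nonneg _) L'.2)
            (mul_le_mul h2 (hgB _) (norm_nonneg _) L.2)
    _ = _ := one_mul _

/-- The far-field estimate, uniform for `x` in a disc. The constant `R + 2` comes from `1 + ‖w‖ ≤ (R
+ 2)(‖w‖ - R)`, an equality at `‖w‖ = R + 1`. -/
lemma norm_kernelDiff_far_le {z₀ x w : ℂ} {C R : ℝ} (hC : 0 < C) (hR : 0 < R)
    (hk : ‖kernel (z₀ - w)‖ ≤ C * (1 + ‖w‖)⁻¹) (hne0 : w ≠ z₀) (hx : ‖x‖ ≤ R)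
    (hwR : R + 1 < ‖w‖) : ‖kernelDiff z₀ x w‖ ≤ (‖z₀‖ + R) * (R + 2) * C * decay ‖w‖ := by
  have hxw : ‖w‖ - R ≤ ‖x - w‖ := by
    have := norm_sub_norm_le w x
    rw [norm_sub_rev] at this
    linarith
  have hne : w ≠ x := by rintro rfl; linarith
  have hkx : ‖kernel (x - w)‖ ≤ (R + 2) * (1 + ‖w‖)⁻¹ := by
    rw [norm_kernel, ← div_eq_mul_inv, le_div_iff₀ (by positivity), ← div_eq_inv_mul,
      div_le_iff₀ (by linarith)]
    nlinarith
  rw [kernelDiff_eq hne0 hne, norm_mul, norm_mul]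
  calc ‖z₀ - x‖ * ‖kernel (x - w)‖ * ‖kernel (z₀ - w)‖
      ≤ (‖z₀‖ + R) * ((R + 2) * (1 + ‖w‖)⁻¹) * (C * (1 + ‖w‖)⁻¹) := by
        gcongr
        exact (norm_sub_le _ _).trans (by gcongr)
    _ = (‖z₀‖ + R) * (R + 2) * C * ((1 + ‖w‖) ^ 2)⁻¹ := by rw [sq, mul_inv]; ring
    _ ≤ _ := by gcongr; exact inv_sq_le_decay (norm_nonneg w)

lemma IsNice.integrable_far_integrand (h : IsNice C₀ μ) {z₀ : ℂ} (hz₀ : z₀ ∉ μ.support)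
    {φ ψ : ℂ → ℂ} (hφ : IsLipZero φ) (hψ : IsLipZero ψ) {R : ℝ} (hR : 0 < R)
    (hψR : tsupport ψ ⊆ Metric.closedBall 0 R) (hφR : ∀ w, ‖w‖ ≤ R + 1 → φ w = 1)
    (hφ1 : ∀ w, ‖1 - φ w‖ ≤ 1) :
    Integrable (fun p : ℂ × ℂ =>
      ψ p.1 * ((1 - φ p.2) * (kernel (p.1 - p.2) - kernel (z₀ - p.2)))) (μ.prod μ) := by
  have := h.isLocallyFiniteMeasure
  obtain ⟨C, hC, hk⟩ := exists_norm_kernel_sub_le hz₀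
  have hm : Measurable (fun p : ℂ × ℂ =>
      ψ p.1 * ((1 - φ p.2) * (kernel (p.1 - p.2) - kernel (z₀ - p.2)))) := by
    have := measurable_kernel
    have := hφ.continuous
    have := hψ.continuous
    fun_prop
  have hb : Integrable (fun p : ℂ × ℂ =>
      ((‖z₀‖ + R) * (R + 2) * C * ‖ψ p.1‖) * decay ‖p.2‖) (μ.prod μ) :=
    (hψ.integrable.norm.const_mul _).mul_prod h.integrable_decay_norm
  refine hb.mono' hm.aestronglyMeasurable ?_
  have hae : ∀ᵐ p ∂(μ.prod μ), p.2 ∈ μ.support :=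
    Measure.quasiMeasurePreserving_snd.ae (ae_mem_support μ)
  filter_upwards [hae] with ⟨x, w⟩ hw
  simp only at hw ⊢
  have hnn := decay_nonneg (norm_nonneg w)
  by_cases hx : ‖x‖ ≤ R
  swap
  · have : ψ x = 0 := image_eq_zero_of_notMem_tsupport fun h' => hx (by simpa using hψR h')
    simp [this]
  by_cases hwR : ‖w‖ ≤ R + 1
  · rw [hφR w hwR]
    simp only [sub_self, zero_mul, mul_zero, norm_zero]
    positivity
  rw [not_le] at hwR
  have hfar := norm_kernelDiff_far_le hC hR (hk w hw) (by rintro rfl; exact hz₀ hw) hx hwR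
  rw [← kernelDiff, norm_mul, norm_mul]
  calc ‖ψ x‖ * (‖1 - φ w‖ * ‖kernelDiff z₀ x w‖)
      ≤ ‖ψ x‖ * (1 * ((‖z₀‖ + R) * (R + 2) * C * decay ‖w‖)) := by
        gcongr
        exact hφ1 w
    _ = _ := by ring

lemma IsNice.integrable_kernel_mul (h : IsNice C₀ μ) {z₀ : ℂ} (hz₀ : z₀ ∉ μ.support)
    {φ : ℂ → ℂ} (hφ : IsLipZero φ) : Integrable (fun w => kernel (z₀ - w) * φ w) μ := by
  have := h.isLocallyFiniteMeasure
  obtain ⟨C, hC, hk⟩ := exists_norm_kernel_sub_le hz₀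
  refine hφ.integrable.bdd_mul (c := C)
    (measurable_kernel.comp (measurable_const.sub measurable_id)).aestronglyMeasurable ?_
  filter_upwards [ae_mem_support μ] with w hw
  refine (hk w hw).trans (mul_le_of_le_one_right hC.le (inv_le_one_of_one_le₀ ?_))
  linarith [norm_nonneg w]

/-- Averaging the last two terms of the definition with their images under exchanging the variables
makes `φ` cancel. Without the cutoff, the pairing is visibly linear in `ψ` and a limit over test
functions can be taken. -/
lemma IsNice.tildePairing_eq (h : IsNice C₀ μ) {z₀ : ℂ} (hz₀ : z₀ ∉ μ.support)
    {φ ψ : ℂ → ℂ} (hφ : IsLipZero φ) (hψ : IsLipZero ψ) {R : ℝ} (hR : 0 < R)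
    (hψR : tsupport ψ ⊆ Metric.closedBall 0 R) (hφR : ∀ w, ‖w‖ ≤ R + 1 → φ w = 1)
    (hφ1 : ∀ w, ‖1 - φ w‖ ≤ 1) :
    Integrable (symIntegrand z₀ ψ) (μ.prod μ) ∧
      tildePairing μ z₀ φ ψ = ∫ p, symIntegrand z₀ ψ p ∂(μ.prod μ) := by
  have := h.isLocallyFiniteMeasure
  have h1 := integrable_pairing_integrand (μ := μ) hφ hψ
  have h2 : Integrable (fun p : ℂ × ℂ => ψ p.1 * (kernel (z₀ - p.2) * φ p.2)) (μ.prod μ) :=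
    hψ.integrable.mul_prod (h.integrable_kernel_mul hz₀ hφ)
  have h3 := h.integrable_far_integrand hz₀ hφ hψ hR hψR hφR hφ1
  have e1 : symIntegrand z₀ ψ = fun p : ℂ × ℂ =>
      kernel (p.1 - p.2) * ((1 / 2) * (φ p.2 * ψ p.1 - φ p.1 * ψ p.2))
      - (1 / 2) * (ψ p.1 * (kernel (z₀ - p.2) * φ p.2) + ψ p.2 * (kernel (z₀ - p.1) * φ p.1))
      + (1 / 2) * (ψ p.1 * ((1 - φ p.2) * (kernel (p.1 - p.2) - kernel (z₀ - p.2)))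
        + ψ p.2 * ((1 - φ p.1) * (kernel (p.2 - p.1) - kernel (z₀ - p.1)))) := by
    ext p
    have : kernel (p.2 - p.1) = - kernel (p.1 - p.2) := by
      simp only [kernel]; rw [← neg_sub, div_neg]
    rw [this, symIntegrand]
    ring
  have h2' : Integrable (fun p : ℂ × ℂ => ψ p.2 * (kernel (z₀ - p.1) * φ p.1)) (μ.prod μ) :=
    h2.swap
  have h3' : Integrable (fun p : ℂ × ℂ =>
      ψ p.2 * ((1 - φ p.1) * (kernel (p.2 - p.1) - kernel (z₀ - p.1)))) (μ.prod μ) := h3.swap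
  have i2 : ∫ p : ℂ × ℂ, ψ p.2 * (kernel (z₀ - p.1) * φ p.1) ∂(μ.prod μ)
      = ∫ p : ℂ × ℂ, ψ p.1 * (kernel (z₀ - p.2) * φ p.2) ∂(μ.prod μ) :=
    integral_prod_swap (fun p : ℂ × ℂ => ψ p.1 * (kernel (z₀ - p.2) * φ p.2))
  have i3 : ∫ p : ℂ × ℂ, ψ p.2 * ((1 - φ p.1) * (kernel (p.2 - p.1) - kernel (z₀ - p.1)))
        ∂(μ.prod μ)
      = ∫ p : ℂ × ℂ, ψ p.1 * ((1 - φ p.2) * (kernel (p.1 - p.2) - kernel (z₀ - p.2)))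
        ∂(μ.prod μ) :=
    integral_prod_swap (fun p : ℂ × ℂ =>
      ψ p.1 * ((1 - φ p.2) * (kernel (p.1 - p.2) - kernel (z₀ - p.2))))
  have h12 := (h2.add h2').const_mul (1 / 2)
  have h13 := (h3.add h3').const_mul (1 / 2)
  simp only [Pi.add_apply] at h12 h13
  refine ⟨?_, ?_⟩
  · rw [e1]
    exact (h1.sub h12).add h13
  · rw [e1]
    refine Eq.trans ?_ (integral_add (h1.sub h12) h13).symm
    rw [integral_sub' h1 h12, integral_const_mul,
      integral_const_mul, integral_add h2 h2', integral_add h3 h3', i2, i3, tildePairing, pairing,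
      integral_prod_mul ψ (fun w => kernel (z₀ - w) * φ w), integral_prod _ h3]
    simp_rw [integral_const_mul]
    ring

lemma symIntegrand_add (z₀ : ℂ) (f g : ℂ → ℂ) (p : ℂ × ℂ) :
    symIntegrand z₀ (f + g) p = symIntegrand z₀ f p + symIntegrand z₀ g p := by
  simp only [symIntegrand, Pi.add_apply]; ring

lemma symIntegrand_const_smul (z₀ c : ℂ) (f : ℂ → ℂ) (p : ℂ × ℂ) :
    symIntegrand z₀ (c • f) p = c * symIntegrand z₀ f p := by
  simp only [symIntegrand, Pi.smul_apply, smul_eq_mul]; ring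

lemma IsNice.integrable_symIntegrand (h : IsNice C₀ μ) {z₀ : ℂ} (hz₀ : z₀ ∉ μ.support)
    {ψ : ℂ → ℂ} (hψ : IsLipZero ψ) : Integrable (symIntegrand z₀ ψ) (μ.prod μ) := by
  obtain ⟨R, hR, hψR⟩ := hψ.exists_radius
  obtain ⟨φ, hφ, hφR, hφ1⟩ := exists_cutoff (R := R + 1) (by linarith)
  exact (h.tildePairing_eq hz₀ hφ hψ hR hψR hφR hφ1).1

/-! ### Reflectionlessness tested on functions of arbitrary mean -/

lemma exists_bump_integral_pos [IsLocallyFiniteMeasure μ] {p : ℂ} (hp : p ∈ μ.support) {ε : ℝ}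
    (hε : 0 < ε) : ∃ η : ℂ → ℝ, ContDiff ℝ 1 η ∧ HasCompactSupport η ∧
      tsupport η ⊆ Metric.ball p ε ∧ 0 < ∫ w, η w ∂μ := by
  let b : ContDiffBump p := ⟨ε / 4, ε / 2, by linarith, by linarith⟩
  refine ⟨b, b.contDiff, b.hasCompactSupport, ?_, ?_⟩
  · rw [b.tsupport_eq]
    exact Metric.closedBall_subset_ball (by change ε / 2 < ε; linarith)
  · rw [integral_pos_iff_support_of_nonneg (fun w => b.nonneg' w)
      (b.continuous.integrable_of_hasCompactSupport b.hasCompactSupport), b.support_eq]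
    exact (Measure.mem_support_iff_forall p).1 hp _ (Metric.ball_mem_nhds _ b.rOut_pos)

/-- For a reflectionless measure, `⟨C̃_μ(1), ψ⟩_μ` is a multiple of `∫ ψ dμ`. -/
lemma IsReflectionless.exists_integral_symIntegrand_eq (hrefl : IsReflectionless μ)
    (h : IsNice C₀ μ) (hμ : μ.support.Nonempty) :
    ∃ z₀ ∉ μ.support, ∃ α : ℂ, ∀ ψ, IsLipZero ψ →
      ∫ p, symIntegrand z₀ ψ p ∂(μ.prod μ) = α * ∫ w, ψ w ∂μ := by
  have := h.isLocallyFiniteMeasure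
  obtain ⟨z₀, hz₀, H⟩ := hrefl
  have hzero : ∀ ψ, IsLipZero ψ → ∫ w, ψ w ∂μ = 0 →
      ∫ p, symIntegrand z₀ ψ p ∂(μ.prod μ) = 0 := by
    intro ψ hψ hint
    obtain ⟨L, hL⟩ := hψ.1
    -- Rescaling meets the Lipschitz bound `1`; `L + 1` replaces `L` to stay nonzero.
    set c : ℂ := (((L + 1 : NNReal) : ℝ) : ℂ) with hc
    have hc0 : c ≠ 0 := by rw [hc]; norm_cast; positivity
    have hψ' := hψ.const_smul c⁻¹
    obtain ⟨R, hR, hψR⟩ := hψ'.exists_radius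
    obtain ⟨φ, hφ, hφR, hφ1⟩ := exists_cutoff (R := R + 1) (by linarith)
    have hmem : c⁻¹ • ψ ∈ MeanZeroLip μ := by
      refine ⟨?_, hψ'.2, ?_⟩
      · refine LipschitzWith.weaken ((lipschitzWith_smul c⁻¹).comp hL) ?_
        rw [nnnorm_inv, ← NNReal.coe_le_coe]
        simp only [hc, NNReal.coe_mul, NNReal.coe_inv, coe_nnnorm, Complex.norm_real,
          Real.norm_eq_abs, NNReal.abs_eq, NNReal.coe_one]
        rw [inv_mul_le_iff₀ (by positivity)]
        simp
      · simp only [Pi.smul_apply, integral_smul, hint, smul_zero]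
    have hev : ∀ᶠ ξ in 𝓝ˢ (tsupport (c⁻¹ • ψ)), φ ξ = 1 := by
      have hopen : Metric.ball (0 : ℂ) (R + 1) ∈ 𝓝ˢ (tsupport (c⁻¹ • ψ)) :=
        Metric.isOpen_ball.mem_nhdsSet.2 (hψR.trans (Metric.closedBall_subset_ball (by linarith)))
      filter_upwards [hopen] with w hw
      exact hφR w (by rw [mem_ball_zero_iff] at hw; exact hw.le)
    have := H _ hmem φ hφ hev
    rw [(h.tildePairing_eq hz₀ hφ hψ' hR hψR hφR hφ1).2] at this
    simp_rw [symIntegrand_const_smul, integral_const_mul] at this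
    exact (mul_eq_zero.1 this).resolve_left (inv_ne_zero hc0)
  obtain ⟨q, hq⟩ := hμ
  obtain ⟨η, hη, hs, -, hpos⟩ := exists_bump_integral_pos hq one_pos
  obtain ⟨φ, hφ, hφ0⟩ : ∃ φ : ℂ → ℂ, IsLipZero φ ∧ (∫ w, φ w ∂μ) ≠ 0 := by
    refine ⟨fun w => (η w : ℂ), isLipZero_of_contDiff (Complex.ofRealCLM.contDiff.comp hη)
      (hs.comp_left (g := fun x : ℝ => (x : ℂ)) Complex.ofReal_zero), ?_⟩
    simp only
    rw [integral_complex_ofReal, Complex.ofReal_ne_zero]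
    exact hpos.ne'
  -- A linear functional vanishing on the kernel of `ψ ↦ ∫ ψ dμ` is a multiple of it; `α` is read
  -- off from one bump of nonzero mean.
  refine ⟨z₀, hz₀, (∫ p, symIntegrand z₀ φ p ∂(μ.prod μ)) / ∫ w, φ w ∂μ, fun ψ hψ => ?_⟩
  set c : ℂ := -((∫ w, ψ w ∂μ) / ∫ w, φ w ∂μ) with hc
  have := hzero (ψ + c • φ) (hψ.add (hφ.const_smul c)) (by
    simp only [Pi.add_apply, Pi.smul_apply]
    rw [integral_add hψ.integrable (g := fun w => c • φ w) (hφ.integrable.smul c),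
      integral_smul, hc, smul_eq_mul]
    field_simp
    ring)
  simp_rw [symIntegrand_add, symIntegrand_const_smul] at this
  rw [integral_add (h.integrable_symIntegrand hz₀ hψ)
    ((h.integrable_symIntegrand hz₀ hφ).const_mul c), integral_const_mul, hc] at this
  field_simp
  field_simp at this
  linear_combination this

/-! ### The quadratic equation for the Cauchy transform -/

lemma contDiffAt_kernel_sub {z w : ℂ} (h : w ≠ z) :
    ContDiffAt ℝ 1 (fun w => kernel (z - w)) w := by
  simp only [kernel, one_div]
  exact (contDiffAt_const.sub contDiffAt_id).inv (sub_ne_zero.2 h.symm)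

/-- Off the support, the kernel can be smoothed near its pole without changing it on the
support. -/
lemma exists_contDiff_eq_kernel_sub {z : ℂ} (hz : z ∉ μ.support) :
    ∃ g : ℂ → ℂ, ContDiff ℝ 1 g ∧ ∀ w ∈ μ.support, g w = kernel (z - w) := by
  obtain ⟨d, hd, hball⟩ := Metric.isOpen_iff.1 Measure.isOpen_compl_support z hz
  let b : ContDiffBump z := ⟨d / 2, d, by linarith, by linarith⟩
  refine ⟨fun w => (1 - (b w : ℂ)) * kernel (z - w), contDiff_iff_contDiffAt.2 fun w => ?_,
    fun w hw => ?_⟩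
  · rcases eq_or_ne w z with rfl | h
    · have : (fun x => (1 - (b x : ℂ)) * kernel (w - x)) =ᶠ[𝓝 w] fun _ => 0 := by
        filter_upwards [b.eventuallyEq_one] with x hx
        simp [hx]
      exact contDiffAt_const.congr_of_eventuallyEq this
    · exact (contDiffAt_const.sub
        (Complex.ofRealCLM.contDiff.contDiffAt.comp w b.contDiffAt)).mul (contDiffAt_kernel_sub h)
  · have : b w = 0 := b.zero_of_le_dist (by
      by_contra hlt
      exact hball (by simpa using hlt) hw)
    simp [this]

/-- A sequence of uniformly Lipschitz cutoffs exhausting the plane. -/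
lemma exists_cutoff_seq : ∃ (χ : ℕ → ℂ → ℂ) (L : ℝ), 0 ≤ L ∧ (∀ N, ContDiff ℝ 1 (χ N)) ∧
    (∀ N, HasCompactSupport (χ N)) ∧ (∀ N w, ‖χ N w‖ ≤ 1) ∧
    (∀ N x w, ‖χ N x - χ N w‖ ≤ L * ‖x - w‖) ∧ ∀ w, Tendsto (fun N => χ N w) atTop (𝓝 1) := by
  let c : ContDiffBump (0 : ℂ) := ⟨1, 2, one_pos, one_lt_two⟩
  set f : ℂ → ℂ := fun w => (c w : ℂ) with hf
  have hfd : ContDiff ℝ 1 f := Complex.ofRealCLM.contDiff.comp c.contDiff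
  have hfs : HasCompactSupport f :=
    c.hasCompactSupport.comp_left (g := fun x : ℝ => (x : ℂ)) Complex.ofReal_zero
  obtain ⟨L, hL⟩ := hfd.lipschitzWith_of_hasCompactSupport hfs one_ne_zero
  have ht : ∀ N : ℕ, 0 < ((N : ℝ) + 1)⁻¹ := fun N => by positivity
  have ht1 : ∀ N : ℕ, ((N : ℝ) + 1)⁻¹ ≤ 1 := fun N => inv_le_one_of_one_le₀ (by simp)
  -- Dilating a fixed bump by factors at least one cannot increase its Lipschitz constant.
  refine ⟨fun N w => f (((N : ℝ) + 1)⁻¹ • w), L, L.2, fun N => hfd.comp (contDiff_const_smul _),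
    fun N => hfs.comp_smul (ht N).ne', fun N w => ?_, fun N x w => ?_, fun w => ?_⟩
  · rw [hf, Complex.norm_real, Real.norm_of_nonneg (c.nonneg' _)]
    exact c.le_one
  · have := hL.dist_le_mul (((N : ℝ) + 1)⁻¹ • x) (((N : ℝ) + 1)⁻¹ • w)
    rw [dist_eq_norm, dist_eq_norm, ← smul_sub, norm_smul, Real.norm_of_nonneg (ht N).le] at this
    refine this.trans ?_
    gcongr
    exact mul_le_of_le_one_left (norm_nonneg _) (ht1 N)
  · obtain ⟨N₀, hN₀⟩ := exists_nat_ge ‖w‖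
    refine tendsto_const_nhds.congr' ?_
    filter_upwards [eventually_ge_atTop N₀] with N hN
    have : c (((N : ℝ) + 1)⁻¹ • w) = 1 := by
      refine c.one_of_mem_closedBall ?_
      rw [mem_closedBall_zero_iff, norm_smul, Real.norm_of_nonneg (ht N).le,
        inv_mul_le_iff₀ (by positivity)]
      have : (N₀ : ℝ) ≤ N := by exact_mod_cast hN
      change ‖w‖ ≤ (N + 1 : ℝ) * 1
      linarith
    rw [hf]
    simp only
    rw [this, Complex.ofReal_one]

/-- Linear growth excludes atoms, so the diagonal is null. It has to be discarded because the
partial-fraction identity below divides by `x - w`. -/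
lemma IsNice.ae_prod_ne (h : IsNice C₀ μ) : ∀ᵐ p : ℂ × ℂ ∂(μ.prod μ), p.1 ≠ p.2 := by
  have := h.isLocallyFiniteMeasure
  have := h.nullSingletonClass
  have hm : MeasurableSet {p : ℂ × ℂ | p.1 ≠ p.2} :=
    (measurableSet_eq_fun measurable_fst measurable_snd).compl
  rw [Measure.ae_prod_iff_ae_ae hm]
  refine Eventually.of_forall fun x => ?_
  have : {x}ᶜ ∈ ae μ := by rw [mem_ae_iff, compl_compl]; exact measure_singleton x
  filter_upwards [this] with w hw
  exact fun h => hw h.symm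

/-- Without `χ`, the identity `K(x - w)(K(z - x) - K(z - w)) = K(z - x) K(z - w)`, used for `z` and
for `z₀`, makes everything collapse to half the product of the two kernel differences. The second
summand is the commutator error caused by `χ`. -/
lemma symIntegrand_cutoff_eq {z₀ z x w : ℂ} {χ ψ : ℂ → ℂ} (hx0 : x ≠ z₀) (hx : x ≠ z)
    (hw0 : w ≠ z₀) (hw : w ≠ z) (hxw : x ≠ w) (hψx : ψ x = χ x * kernelDiff z₀ z x)
    (hψw : ψ w = χ w * kernelDiff z₀ z w) :
    symIntegrand z₀ ψ (x, w) = (1 / 2) * χ x * (kernelDiff z₀ z x * kernelDiff z₀ z w)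
      + (1 / 2) * (z₀ - z) * ((χ x - χ w) * kernel (x - w)) *
        (kernel (z₀ - x) * kernel (z - w)) := by
  have h1 : z₀ - x ≠ 0 := sub_ne_zero.2 hx0.symm
  have h2 : z - x ≠ 0 := sub_ne_zero.2 hx.symm
  have h3 : z₀ - w ≠ 0 := sub_ne_zero.2 hw0.symm
  have h4 : z - w ≠ 0 := sub_ne_zero.2 hw.symm
  have h5 : x - w ≠ 0 := sub_ne_zero.2 hxw
  rw [symIntegrand]
  simp only [hψx, hψw, kernelDiff, kernel]
  field_simp
  ring

/-- The Cauchy transform of a reflectionless measure satisfies a quadratic equation. -/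
lemma IsNice.modTransform_sq (h : IsNice C₀ μ) {z₀ α : ℂ} (hz₀ : z₀ ∉ μ.support)
    (hα : ∀ ψ, IsLipZero ψ → ∫ p, symIntegrand z₀ ψ p ∂(μ.prod μ) = α * ∫ w, ψ w ∂μ)
    {z : ℂ} (hz : z ∉ μ.support) :
    modTransform μ z₀ z ^ 2 = 2 * α * modTransform μ z₀ z := by
  have := h.isLocallyFiniteMeasure
  obtain ⟨g, hg, hgk⟩ := exists_contDiff_eq_kernel_sub hz
  obtain ⟨g₀, hg₀, hgk₀⟩ := exists_contDiff_eq_kernel_sub hz₀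
  obtain ⟨χ, L, hL, hχd, hχs, hχ1, hχL, hχlim⟩ := exists_cutoff_seq
  obtain ⟨Ck, hCk, hk⟩ := exists_norm_kernelDiff_le hz₀ hz
  obtain ⟨C, hC, hC'⟩ := exists_norm_kernel_sub_le hz
  obtain ⟨D, hD, hD'⟩ := exists_norm_kernel_sub_le hz₀
  -- The intended test function is the kernel difference; smoothing its poles off the support and
  -- cutting off at infinity put it in `Lip₀`.
  set ψ : ℕ → ℂ → ℂ := fun N w => χ N w * (g w - g₀ w) with hψ
  have hψL : ∀ N, IsLipZero (ψ N) := fun N =>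
    isLipZero_of_contDiff ((hχd N).mul (hg.sub hg₀)) (hχs N).mul_right
  have hψk : ∀ N, ∀ w ∈ μ.support, ψ N w = χ N w * kernelDiff z₀ z w := fun N w hw => by
    rw [hψ]; simp only; rw [hgk w hw, hgk₀ w hw, kernelDiff]
  have hne : ∀ w ∈ μ.support, w ≠ z := fun w hw => by rintro rfl; exact hz hw
  have hne0 : ∀ w ∈ μ.support, w ≠ z₀ := fun w hw => by rintro rfl; exact hz₀ hw
  have lim1 : Tendsto (fun N => ∫ w, ψ N w ∂μ) atTop (𝓝 (modTransform μ z₀ z)) := by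
    refine tendsto_integral_of_dominated_convergence (fun w => Ck * decay ‖w‖)
      (fun N => (hψL N).continuous.aestronglyMeasurable) (h.integrable_decay_norm.const_mul _)
      (fun N => ?_) ?_
    · filter_upwards [ae_mem_support μ] with w hw
      rw [hψk N w hw, norm_mul]
      exact (mul_le_of_le_one_left (norm_nonneg _) (hχ1 N w)).trans (hk w hw)
    · filter_upwards [ae_mem_support μ] with w hw
      simp_rw [hψk _ w hw]
      simpa using (hχlim w).mul_const (kernelDiff z₀ z w)
  have hae : ∀ᵐ p ∂(μ.prod μ), p.1 ∈ μ.support ∧ p.2 ∈ μ.support ∧ p.1 ≠ p.2 := by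
    filter_upwards [Measure.quasiMeasurePreserving_fst.ae (ae_mem_support μ),
      Measure.quasiMeasurePreserving_snd.ae (ae_mem_support μ), h.ae_prod_ne] with p h1 h2 h3
      using ⟨h1, h2, h3⟩
  have hform : ∀ᵐ p ∂(μ.prod μ), ∀ N, symIntegrand z₀ (ψ N) p =
      (1 / 2) * χ N p.1 * (kernelDiff z₀ z p.1 * kernelDiff z₀ z p.2)
      + (1 / 2) * (z₀ - z) * ((χ N p.1 - χ N p.2) * kernel (p.1 - p.2)) *
        (kernel (z₀ - p.1) * kernel (z - p.2)) := by
    filter_upwards [hae] with p ⟨h1, h2, h3⟩ N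
    exact symIntegrand_cutoff_eq (hne0 _ h1) (hne _ h1) (hne0 _ h2) (hne _ h2) h3
      (hψk N _ h1) (hψk N _ h2)
  have lim2 : Tendsto (fun N => ∫ p, symIntegrand z₀ (ψ N) p ∂(μ.prod μ)) atTop
      (𝓝 (∫ p : ℂ × ℂ, (1 / 2) * (kernelDiff z₀ z p.1 * kernelDiff z₀ z p.2) ∂(μ.prod μ))) := by
    refine tendsto_integral_of_dominated_convergence (fun p => Ck ^ 2 * (decay ‖p.1‖ * decay ‖p.2‖)
      + ‖z₀ - z‖ * (L + 2) * D * C * (2 * (decay ‖p.1‖ * decay ‖p.2‖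
        + decay ‖p.1‖ * decay ‖p.1 - p.2‖)))
      (fun N => (h.integrable_symIntegrand hz₀ (hψL N)).aestronglyMeasurable) ?_ (fun N => ?_) ?_
    · exact (h.integrable_decay_mul_decay.const_mul _).add
        (((h.integrable_decay_mul_decay.add h.integrable_decay_mul_decay_sub).const_mul _).const_mul
          _)
    · filter_upwards [hae, hform] with p ⟨h1, h2, h3⟩ hp
      rw [hp N]
      refine (norm_add_le _ _).trans (add_le_add ?_ ?_)
      · rw [norm_mul, norm_mul, norm_mul]
        calc ‖(1 / 2 : ℂ)‖ * ‖χ N p.1‖ * (‖kernelDiff z₀ z p.1‖ * ‖kernelDiff z₀ z p.2‖)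
            ≤ 1 * 1 * ((Ck * decay ‖p.1‖) * (Ck * decay ‖p.2‖)) := by
              gcongr
              · norm_num
              · exact hχ1 N _
              · exact mul_nonneg hCk.le (decay_nonneg (norm_nonneg _))
              · exact hk _ h1
              · exact hk _ h2
          _ = _ := by ring
      · have h0 : 0 < ‖p.1 - p.2‖ := norm_pos_iff.2 (sub_ne_zero.2 h3)
        -- The Lipschitz bound `L` serves near the diagonal and the trivial bound `2` far from it,
        -- giving a bound independent of `N`.
        have hdiff : ‖(χ N p.1 - χ N p.2) * kernel (p.1 - p.2)‖ ≤
            (L + 2) * (1 + ‖p.1 - p.2‖)⁻¹ := by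
          rw [norm_mul, norm_kernel, ← div_eq_mul_inv, ← div_eq_mul_inv,
            div_le_div_iff₀ h0 (by positivity)]
          have e1 := hχL N p.1 p.2
          have e2 : ‖χ N p.1 - χ N p.2‖ ≤ 2 :=
            (norm_sub_le _ _).trans (by linarith [hχ1 N p.1, hχ1 N p.2])
          nlinarith
        -- The error thus carries three first-order weights, in `x`, `w` and `x - w`, whose product
        -- is dominated by an integrable function.
        have h3w := inv_mul_three_le (norm_nonneg p.1) (norm_nonneg p.2)
          (norm_nonneg (p.1 - p.2)) (by
            have := norm_add_le p.2 (p.1 - p.2); simpa using this)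
        rw [norm_mul, norm_mul, norm_mul (1 / 2 : ℂ), norm_mul (kernel _)]
        calc ‖(1 / 2 : ℂ)‖ * ‖z₀ - z‖ * ‖(χ N p.1 - χ N p.2) * kernel (p.1 - p.2)‖ *
              (‖kernel (z₀ - p.1)‖ * ‖kernel (z - p.2)‖)
            ≤ 1 * ‖z₀ - z‖ * ((L + 2) * (1 + ‖p.1 - p.2‖)⁻¹) *
              ((D * (1 + ‖p.1‖)⁻¹) * (C * (1 + ‖p.2‖)⁻¹)) := by
              gcongr
              · norm_num
              · exact hD' _ h1
              · exact hC' _ h2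
          _ = ‖z₀ - z‖ * (L + 2) * D * C *
              ((1 + ‖p.1‖) * (1 + ‖p.2‖) * (1 + ‖p.1 - p.2‖))⁻¹ := by
              rw [mul_inv, mul_inv]; ring
          _ ≤ _ := by
              gcongr
              exact h3w.trans (le_of_eq (by ring))
    · filter_upwards [hform] with p hp
      simp_rw [hp]
      have t1 := hχlim p.1
      have t2 := hχlim p.2
      have := ((t1.const_mul (1 / 2)).mul_const (kernelDiff z₀ z p.1 * kernelDiff z₀ z p.2)).add
        (((((t1.sub t2).mul_const (kernel (p.1 - p.2))).const_mul ((1 / 2) * (z₀ - z))).mul_const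
          (kernel (z₀ - p.1) * kernel (z - p.2))))
      simpa using this
  -- The error vanishes as `χ` tends to `1`, leaving `½ F(z)² = α F(z)`.
  have key := tendsto_nhds_unique lim2
    ((lim1.const_mul α).congr fun N => (hα _ (hψL N)).symm)
  rw [integral_const_mul, integral_prod_mul] at key
  rw [← modTransform] at key
  linear_combination 2 * key

/-! ### The support is null for area -/

/-- The support of an AD-regular measure has zero area. -/
lemma IsADRegular.volume_support (h : IsADRegular c₀ μ) : volume μ.support = 0 := by
  obtain ⟨⟨C₀, hC₀⟩, hc₀, hAD⟩ := h
  have := hC₀.isLocallyFiniteMeasure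
  have hball : ∀ n : ℕ, volume (μ.support ∩ Metric.ball 0 n) = 0 := by
    intro n
    have hfin : μ (μ.support ∩ Metric.ball 0 n) < ⊤ :=
      (measure_mono Set.inter_subset_right).trans_lt measure_ball_lt_top
    have key : ∀ ε : NNReal, 0 < ε → volume (μ.support ∩ Metric.ball 0 n) ≤
        ε * μ (μ.support ∩ Metric.ball 0 n) := by
      intro ε hε
      have : IsLocallyFiniteMeasure (ε • μ) := inferInstance
      refine (Besicovitch.vitaliFamily volume).measure_le_of_frequently_le (ε • μ)
        Measure.AbsolutelyContinuous.rfl _ fun x hx => ?_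
      refine (Besicovitch.tendsto_filterAt volume x).frequently (Eventually.frequently ?_)
      -- Below this radius `π r² ≤ ε c₀ r`, so area is at most `ε μ` on small discs centred on the
      -- support. Vitali covering passes this to bounded pieces of the support, and then `ε` is
      -- arbitrary.
      have hpos : 0 < (ε : ℝ) * c₀ / Real.pi := by positivity
      filter_upwards [Ioc_mem_nhdsGT hpos] with r hr
      have hr0 : 0 < r := hr.1
      have hr1 : Real.pi * r ≤ ε * c₀ := by
        have := (le_div_iff₀ Real.pi_pos).1 hr.2
        linarith
      calc volume (Metric.closedBall x r) = ENNReal.ofReal (Real.pi * r * r) := by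
            rw [Complex.volume_closedBall, ← ENNReal.ofReal_pow hr0.le,
              ← ENNReal.ofReal_coe_nnreal, NNReal.coe_real_pi, ← ENNReal.ofReal_mul (by positivity)]
            congr 1; ring
        _ ≤ ENNReal.ofReal (ε * (c₀ * r)) := by
            refine ENNReal.ofReal_le_ofReal ?_
            nlinarith
        _ = ε * ENNReal.ofReal (c₀ * r) := by
            rw [ENNReal.ofReal_mul (NNReal.coe_nonneg _), ENNReal.ofReal_coe_nnreal]
        _ ≤ ε * μ (Metric.closedBall x r) := by
            gcongr
            exact (hAD x hx.1 r hr0).trans (measure_mono Metric.ball_subset_closedBall)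
        _ = (ε • μ) (Metric.closedBall x r) := rfl
    by_contra hne
    obtain ⟨ε, hε0, hε⟩ := ENNReal.exists_nnreal_pos_mul_lt hfin.ne hne
    exact absurd (key ε hε0) (not_le.2 hε)
  have : μ.support ⊆ ⋃ n : ℕ, μ.support ∩ Metric.ball 0 n := by
    rw [← Set.inter_iUnion, Metric.iUnion_ball_nat, Set.inter_univ]
  exact measure_mono_null this (measure_iUnion_null hball)

lemma IsADRegular.ae_notMem_support (h : IsADRegular c₀ μ) :
    ∀ᵐ w ∂(volume : Measure ℂ), w ∉ μ.support :=
  measure_eq_zero_iff_ae_notMem.1 h.volume_support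

/-! ### The Cauchy–Pompeiu formula -/

/-- The derivative `∂_x η + i ∂_y η` of a real function `η`. -/
def dbar (η : ℂ → ℝ) (z : ℂ) : ℂ :=
  (fderiv ℝ η z 1 : ℂ) + (fderiv ℝ η z Complex.I : ℂ) * Complex.I

lemma continuous_dbar {η : ℂ → ℝ} (hη : ContDiff ℝ 1 η) : Continuous (dbar η) := by
  have := hη.continuous_fderiv one_ne_zero
  unfold dbar
  fun_prop

lemma hasCompactSupport_dbar {η : ℂ → ℝ} (hs : HasCompactSupport η) :
    HasCompactSupport (dbar η) :=
  (hs.fderiv ℝ).comp_left (g := fun A : ℂ →L[ℝ] ℝ => (A 1 : ℂ) + (A Complex.I : ℂ) * Complex.I)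
    (by simp)

/-- The point `cos θ + i sin θ` of the unit circle. -/
def circlePt (θ : ℝ) : ℂ := (Real.cos θ : ℂ) + (Real.sin θ : ℂ) * Complex.I

lemma continuous_circlePt : Continuous circlePt := by
  unfold circlePt; fun_prop

lemma hasDerivAt_circlePt (θ : ℝ) : HasDerivAt circlePt (Complex.I * circlePt θ) θ := by
  have h := (Real.hasDerivAt_cos θ).ofReal_comp.add
    ((Real.hasDerivAt_sin θ).ofReal_comp.mul_const Complex.I)
  refine h.congr_deriv ?_
  simp only [circlePt, Complex.ofReal_neg]
  linear_combination -(Real.sin θ : ℂ) * Complex.I_sq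

lemma norm_circlePt (θ : ℝ) : ‖circlePt θ‖ = 1 := by
  simpa only [circlePt, Complex.polarCoord_symm_apply, Complex.ofReal_one, one_mul, abs_one] using
    Complex.norm_polarCoord_symm (1, θ)

/-- The Jacobian `r` cancels the pole, and `e^(-iθ)(∂_x + i ∂_y)` is the radial derivative plus `i`
times the unit tangential derivative. -/
lemma kernel_mul_dbar_polar (η : ℂ → ℝ) (ξ : ℂ) {r : ℝ} (hr : 0 < r) (θ : ℝ) :
    r • (kernel (r * circlePt θ) * dbar η (ξ + r * circlePt θ)) =
      (fderiv ℝ η (ξ + r * circlePt θ) (circlePt θ) : ℂ)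
      + (fderiv ℝ η (ξ + r * circlePt θ) (Complex.I * circlePt θ) : ℂ) * Complex.I := by
  set A := fderiv ℝ η (ξ + r * circlePt θ)
  have e1 : circlePt θ = Real.cos θ • (1 : ℂ) + Real.sin θ • Complex.I := by
    simp [circlePt]
  have e2 : Complex.I * circlePt θ = (-Real.sin θ) • (1 : ℂ) + Real.cos θ • Complex.I := by
    rw [circlePt, Complex.real_smul, Complex.real_smul, Complex.ofReal_neg]
    linear_combination (Real.sin θ : ℂ) * Complex.I_sq
  have h0 : circlePt θ ≠ 0 := norm_pos_iff.1 (by rw [norm_circlePt]; exact one_pos)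
  have hr' : (r : ℂ) ≠ 0 := Complex.ofReal_ne_zero.2 hr.ne'
  have hcs : (Real.cos θ : ℂ) ^ 2 + (Real.sin θ : ℂ) ^ 2 = 1 := by
    norm_cast; exact Real.cos_sq_add_sin_sq θ
  rw [e2, e1, map_add, map_add, map_smul, map_smul, map_smul, map_smul, ← e1, kernel, dbar,
    Complex.real_smul]
  change (r : ℂ) * (1 / (r * circlePt θ) * ((A 1 : ℂ) + (A Complex.I : ℂ) * Complex.I)) = _
  simp only [smul_eq_mul, Complex.ofReal_add, Complex.ofReal_mul, Complex.ofReal_neg]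
  have : (r : ℂ) * (1 / (r * circlePt θ) * ((A 1 : ℂ) + (A Complex.I : ℂ) * Complex.I)) =
      ((A 1 : ℂ) + (A Complex.I : ℂ) * Complex.I) / circlePt θ := by
    field_simp
  rw [this, div_eq_iff h0, circlePt]
  linear_combination (-(A 1 : ℂ) - (A Complex.I : ℂ) * Complex.I) * hcs +
    ((A 1 : ℂ) * Real.sin θ ^ 2 - (A Complex.I : ℂ) * Real.sin θ * Real.cos θ) * Complex.I_sq

/-- The Cauchy–Pompeiu formula for compactly supported functions. -/
lemma integral_kernel_mul_dbar {η : ℂ → ℝ} (hη : ContDiff ℝ 1 η) (hs : HasCompactSupport η)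
    (ξ : ℂ) : ∫ z, kernel (z - ξ) * dbar η z = -(2 * Real.pi * η ξ : ℝ) := by
  obtain ⟨R, hR⟩ : ∃ R : ℝ, tsupport η ⊆ Metric.closedBall ξ R :=
    (hs : IsCompact (tsupport η)).isBounded.subset_closedBall ξ
  have hη0 : ∀ r θ : ℝ, R < r → 0 < r → ξ + r * circlePt θ ∉ tsupport η := by
    intro r θ h h0 hmem
    have := hR hmem
    rw [mem_closedBall_iff_norm, add_sub_cancel_left, norm_mul, norm_circlePt, mul_one,
      Complex.norm_real, Real.norm_of_nonneg h0.le] at this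
    linarith
  have hf0 : ∀ r θ : ℝ, R < r → 0 < r → fderiv ℝ η (ξ + r * circlePt θ) = 0 := fun r θ h h0 =>
    image_eq_zero_of_notMem_tsupport fun hmem => hη0 r θ h h0 (tsupport_fderiv_subset ℝ hmem)
  have hcf := hη.continuous_fderiv one_ne_zero
  have hcc := continuous_circlePt
  set ν₁ : Measure ℝ := volume.restrict (Set.Ioi 0) with hν₁
  set ν₂ : Measure ℝ := volume.restrict (Set.Ioo (-Real.pi) Real.pi) with hν₂
  have hint : ∀ u : ℝ → ℂ, Continuous u → Integrable
      (fun p : ℝ × ℝ => (fderiv ℝ η (ξ + p.1 * circlePt p.2) (u p.2) : ℝ)) (ν₁.prod ν₂) := by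
    intro u hu
    rw [hν₁, hν₂, Measure.prod_restrict]
    have hc : Continuous
        (fun p : ℝ × ℝ => (fderiv ℝ η (ξ + p.1 * circlePt p.2) (u p.2) : ℝ)) := by
      refine Continuous.clm_apply (hcf.comp ?_) (hu.comp continuous_snd)
      fun_prop
    have hK : IntegrableOn (fun p : ℝ × ℝ => (fderiv ℝ η (ξ + p.1 * circlePt p.2) (u p.2) : ℝ))
        (Set.Icc 0 R ×ˢ Set.Icc (-Real.pi) Real.pi) (volume.prod volume) :=
      hc.continuousOn.integrableOn_compact (isCompact_Icc.prod isCompact_Icc)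
    refine IntegrableOn.of_forall_sdiff_eq_zero hK
      (measurableSet_Ioi.prod measurableSet_Ioo) fun p hp => ?_
    obtain ⟨⟨h1, h2⟩, h3⟩ := hp
    have h1 : 0 < p.1 := h1
    have : R < p.1 := by
      by_contra hle
      exact h3 ⟨⟨h1.le, not_lt.1 hle⟩, ⟨h2.1.le, h2.2.le⟩⟩
    rw [hf0 _ _ this h1]; rfl
  have hA := hint circlePt hcc
  have hB := hint (fun θ => Complex.I * circlePt θ) (continuous_const.mul hcc)
  have iA : ∫ p : ℝ × ℝ, fderiv ℝ η (ξ + p.1 * circlePt p.2) (circlePt p.2) ∂(ν₁.prod ν₂)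
      = -(2 * Real.pi * η ξ) := by
    rw [integral_prod_symm _ hA]
    -- Along a ray this is the `r`-derivative of `η`, which vanishes far out, so only the value at
    -- `ξ` remains.
    have : ∀ θ, ∫ r, fderiv ℝ η (ξ + (r : ℝ) * circlePt θ) (circlePt θ) ∂ν₁ = - η ξ := by
      intro θ
      have hd : ∀ r ∈ Set.Ici (0 : ℝ), HasDerivAt (fun r : ℝ => η (ξ + r * circlePt θ))
          (fderiv ℝ η (ξ + (r : ℝ) * circlePt θ) (circlePt θ)) r := by
        intro r _
        have h1 : HasDerivAt (fun r : ℝ => ξ + r * circlePt θ) (circlePt θ) r := by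
          simpa using ((hasDerivAt_id r).ofReal_comp.mul_const (circlePt θ)).const_add ξ
        exact ((hη.differentiable one_ne_zero) _).hasFDerivAt.comp_hasDerivAt r h1
      have hev : (fun r : ℝ => η (ξ + r * circlePt θ)) =ᶠ[atTop] fun _ => 0 := by
        filter_upwards [eventually_gt_atTop R, eventually_gt_atTop 0] with r h1 h2
        exact image_eq_zero_of_notMem_tsupport (hη0 r θ h1 h2)
      have hio : IntegrableOn (fun r : ℝ => fderiv ℝ η (ξ + r * circlePt θ) (circlePt θ))
          (Set.Ioi 0) := by
        have hK : IntegrableOn (fun r : ℝ => fderiv ℝ η (ξ + r * circlePt θ) (circlePt θ))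
            (Set.Icc 0 R) := by
          refine ContinuousOn.integrableOn_compact isCompact_Icc (Continuous.continuousOn ?_)
          refine Continuous.clm_apply (hcf.comp ?_) continuous_const
          fun_prop
        refine IntegrableOn.of_forall_sdiff_eq_zero hK measurableSet_Ioi fun r hr => ?_
        have h1 : 0 < r := hr.1
        have : R < r := by
          by_contra hle
          exact hr.2 ⟨h1.le, not_lt.1 hle⟩
        rw [hf0 _ _ this h1]; rfl
      have := integral_Ioi_of_hasDerivAt_of_tendsto' hd hio
        (tendsto_const_nhds.congr' hev.symm)
      rw [hν₁, this]
      simp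
    simp_rw [this]
    rw [integral_const, hν₂, measureReal_restrict_apply_univ, Real.volume_real_Ioo_of_le
      (by linarith [Real.pi_pos]), smul_eq_mul]
    ring
  have iB : ∫ p : ℝ × ℝ, fderiv ℝ η (ξ + p.1 * circlePt p.2) (Complex.I * circlePt p.2)
      ∂(ν₁.prod ν₂) = 0 := by
    rw [integral_prod _ hB]
    refine integral_eq_zero_of_ae ?_
    rw [hν₁]
    filter_upwards [self_mem_ae_restrict measurableSet_Ioi] with r hr
    have hr : 0 < r := hr
    -- On a circle the tangential term is, up to the factor `r`, the derivative of a `2π`-periodic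
    -- function.
    have hd : ∀ θ : ℝ, HasDerivAt (fun θ : ℝ => η (ξ + r * circlePt θ))
        (r * fderiv ℝ η (ξ + r * circlePt θ) (Complex.I * circlePt θ)) θ := by
      intro θ
      have h1 : HasDerivAt (fun θ : ℝ => ξ + r * circlePt θ) (r • (Complex.I * circlePt θ)) θ :=
        ((hasDerivAt_circlePt θ).const_mul (r : ℂ)).const_add ξ
      have := ((hη.differentiable one_ne_zero) _).hasFDerivAt.comp_hasDerivAt θ h1
      rwa [map_smul, smul_eq_mul] at this
    have hcont : Continuous fun θ : ℝ =>
        r * fderiv ℝ η (ξ + r * circlePt θ) (Complex.I * circlePt θ) := by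
      refine continuous_const.mul (Continuous.clm_apply (hcf.comp ?_) ?_) <;> fun_prop
    have := intervalIntegral.integral_eq_sub_of_hasDerivAt (a := -Real.pi) (b := Real.pi)
      (fun θ _ => hd θ) (hcont.intervalIntegrable _ _)
    have hpm : circlePt (-Real.pi) = circlePt Real.pi := by simp [circlePt]
    rw [hpm, sub_self, intervalIntegral.integral_const_mul] at this
    have h0 := (mul_eq_zero.1 this).resolve_left hr.ne'
    rw [intervalIntegral.integral_of_le (by linarith [Real.pi_pos]),
      integral_Ioc_eq_integral_Ioo] at h0
    exact h0
  calc ∫ z, kernel (z - ξ) * dbar η z = ∫ z, kernel z * dbar η (ξ + z) := by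
        rw [← integral_add_left_eq_self (fun z => kernel (z - ξ) * dbar η z) ξ]
        simp only [add_sub_cancel_left]
    _ = ∫ p in polarCoord.target, p.1 • (kernel (Complex.polarCoord.symm p) *
          dbar η (ξ + Complex.polarCoord.symm p)) :=
        (Complex.integral_comp_polarCoord_symm _).symm
    _ = ∫ p : ℝ × ℝ, (((fderiv ℝ η (ξ + p.1 * circlePt p.2) (circlePt p.2) : ℝ) : ℂ) +
          ((fderiv ℝ η (ξ + p.1 * circlePt p.2) (Complex.I * circlePt p.2) : ℝ) : ℂ) * Complex.I)
          ∂(ν₁.prod ν₂) := by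
        rw [hν₁, hν₂, Measure.prod_restrict, ← Measure.volume_eq_prod]
        refine setIntegral_congr_fun (measurableSet_Ioi.prod measurableSet_Ioo) fun p hp => ?_
        simp only [Complex.polarCoord_symm_apply]
        exact kernel_mul_dbar_polar η ξ hp.1 p.2
    _ = _ := by
        rw [integral_add hA.ofReal (hB.ofReal.mul_const _), integral_mul_const,
          integral_complex_ofReal, integral_complex_ofReal, iA, iB]
        simp

/-! ### The distributional `∂̄` of the modified transform -/

/-- The Cauchy kernel is locally integrable with respect to area. -/
lemma integrable_indicator_kernel (ρ : ℝ) :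
    Integrable ((Metric.ball (0 : ℂ) ρ).indicator kernel) := by
  refine ⟨(measurable_kernel.indicator measurableSet_ball).aestronglyMeasurable, ?_⟩
  rw [hasFiniteIntegral_iff_enorm, ← Complex.lintegral_comp_polarCoord_symm]
  set B : Set (ℝ × ℝ) := Set.Ioo 0 ρ ×ˢ Set.Ioo (-Real.pi) Real.pi with hB
  have hBm : MeasurableSet B := measurableSet_Ioo.prod measurableSet_Ioo
  calc _ ≤ ∫⁻ p in polarCoord.target, B.indicator (fun _ => 1) p := by
        refine setLIntegral_mono_ae' (measurableSet_Ioi.prod measurableSet_Ioo)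
          (Eventually.of_forall fun p hp => ?_)
        have hp0 : 0 < p.1 := hp.1
        by_cases h : p ∈ B
        · rw [Set.indicator_of_mem h]
          calc ENNReal.ofReal p.1 •
                ‖(Metric.ball (0 : ℂ) ρ).indicator kernel (Complex.polarCoord.symm p)‖ₑ
              ≤ ENNReal.ofReal p.1 * ‖kernel (Complex.polarCoord.symm p)‖ₑ := by
                rw [smul_eq_mul]
                gcongr
                exact enorm_indicator_le_enorm_self _ _
            _ = 1 := by
                rw [← ofReal_norm, norm_kernel, Complex.norm_polarCoord_symm,
                  abs_of_pos hp0, ← ENNReal.ofReal_mul hp0.le, mul_inv_cancel₀ hp0.ne',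
                  ENNReal.ofReal_one]
        · have : Complex.polarCoord.symm p ∉ Metric.ball (0 : ℂ) ρ := by
            rw [mem_ball_zero_iff, Complex.norm_polarCoord_symm, abs_of_pos hp0]
            exact fun hlt => h ⟨⟨hp0, hlt⟩, hp.2⟩
          rw [Set.indicator_of_notMem this]
          simp
    _ ≤ ∫⁻ p, B.indicator (fun _ => 1) p := setLIntegral_le_lintegral _ _
    _ = volume B := by rw [lintegral_indicator_const hBm, one_mul]
    _ < ⊤ := by
        rw [hB, Measure.volume_eq_prod, Measure.prod_prod, Real.volume_Ioo, Real.volume_Ioo]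
        exact ENNReal.mul_lt_top ENNReal.ofReal_lt_top ENNReal.ofReal_lt_top

lemma integrable_fderiv_apply {η : ℂ → ℝ} (hη : ContDiff ℝ 1 η) (hs : HasCompactSupport η)
    (v : ℂ) : Integrable (fun z => fderiv ℝ η z v) :=
  ((hη.continuous_fderiv one_ne_zero).clm_apply continuous_const).integrable_of_hasCompactSupport
    ((hs.fderiv ℝ).comp_left (g := fun A : ℂ →L[ℝ] ℝ => A v) (by simp))

lemma integral_fderiv_eq_zero {η : ℂ → ℝ} (hη : ContDiff ℝ 1 η) (hs : HasCompactSupport η)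
    (v : ℂ) : ∫ z, fderiv ℝ η z v = 0 := by
  have hi := integrable_fderiv_apply hη hs v
  have := integral_mul_fderiv_eq_neg_fderiv_mul_of_integrable (μ := (volume : Measure ℂ))
    (f := fun _ => (1 : ℝ)) (g := η) (v := v) (by simp) (by simpa using hi)
    (by simpa using hη.continuous.integrable_of_hasCompactSupport hs)
    (fun x _ => differentiableAt_const _) (fun x _ => (hη.differentiable one_ne_zero) x)
  simpa using this

lemma integral_dbar {η : ℂ → ℝ} (hη : ContDiff ℝ 1 η) (hs : HasCompactSupport η) :
    ∫ z, dbar η z = 0 := by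
  unfold dbar
  rw [integral_add (integrable_fderiv_apply hη hs 1).ofReal
    ((integrable_fderiv_apply hη hs Complex.I).ofReal.mul_const _), integral_mul_const,
    integral_complex_ofReal, integral_complex_ofReal, integral_fderiv_eq_zero hη hs,
    integral_fderiv_eq_zero hη hs]
  simp

lemma integrable_kernel_mul_dbar {η : ℂ → ℝ} (hη : ContDiff ℝ 1 η) (hs : HasCompactSupport η)
    (ξ : ℂ) : Integrable (fun z => kernel (z - ξ) * dbar η z) := by
  obtain ⟨R, hR⟩ : ∃ R : ℝ, tsupport (dbar η) ⊆ Metric.ball ξ R :=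
    (hasCompactSupport_dbar hs : IsCompact _).isBounded.subset_ball ξ
  obtain ⟨M, hM⟩ := (hasCompactSupport_dbar hs).exists_bound_of_continuous (continuous_dbar hη)
  have h := ((integrable_indicator_kernel R).comp_sub_right ξ).mul_bdd
    (continuous_dbar hη).aestronglyMeasurable (Eventually.of_forall hM)
  refine h.congr (Eventually.of_forall fun z => ?_)
  by_cases hz : z ∈ Metric.ball ξ R
  · simp only
    rw [Set.indicator_of_mem (by simpa [dist_eq_norm] using hz)]
  · have : dbar η z = 0 := image_eq_zero_of_notMem_tsupport fun h => hz (hR h)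
    simp [this]

/-- This justifies Fubini for area times `μ`. For bounded `w` the kernel is locally integrable in
area and `μ` is finite; for distant `w` the far-field decay applies. -/
lemma IsNice.integrable_kernelDiff_mul_dbar (h : IsNice C₀ μ) {z₀ : ℂ} (hz₀ : z₀ ∉ μ.support)
    {η : ℂ → ℝ} (hη : ContDiff ℝ 1 η) (hs : HasCompactSupport η) :
    Integrable (fun p : ℂ × ℂ => kernelDiff z₀ p.1 p.2 * dbar η p.1) (volume.prod μ) := by
  have := h.isLocallyFiniteMeasure
  have hDs := hasCompactSupport_dbar hs
  have hDc := continuous_dbar hη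
  obtain ⟨M, hM⟩ := hDs.exists_bound_of_continuous hDc
  obtain ⟨R, hR0, hR⟩ : ∃ R : ℝ, 0 < R ∧ tsupport (dbar η) ⊆ Metric.closedBall 0 R := by
    obtain ⟨R, hR⟩ := (hDs : IsCompact _).isBounded.subset_closedBall 0
    exact ⟨max R 1, by positivity, hR.trans (Metric.closedBall_subset_closedBall (le_max_left _ _))⟩
  obtain ⟨C, hC, hk⟩ := exists_norm_kernel_sub_le hz₀
  have hDi : Integrable (dbar η) := hDc.integrable_of_hasCompactSupport hDs
  set B : Set ℂ := Metric.closedBall 0 (R + 1) with hB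
  have hBi : Integrable (B.indicator fun _ => (1 : ℝ)) μ :=
    (integrable_indicator_iff measurableSet_closedBall).2
      (integrableOn_const (isCompact_closedBall _ _).measure_lt_top.ne)
  have i1 : Integrable (fun p : ℂ × ℂ => ‖dbar η p.1‖ * ((‖z₀‖ + R) * (R + 2) * C * decay ‖p.2‖))
      (volume.prod μ) := hDi.norm.mul_prod (h.integrable_decay_norm.const_mul _)
  have i2 : Integrable (fun p : ℂ × ℂ => B.indicator (fun _ => (1 : ℝ)) p.2 *
      ‖(Metric.ball (0 : ℂ) (2 * R + 2)).indicator kernel (p.1 - p.2)‖) (volume.prod μ) :=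
    Integrable.convolution_integrand (ContinuousLinearMap.mul ℝ ℝ) hBi
      (integrable_indicator_kernel (2 * R + 2)).norm
  have i3 : Integrable (fun p : ℂ × ℂ => ‖dbar η p.1‖ * (C * B.indicator (fun _ => (1 : ℝ)) p.2))
      (volume.prod μ) := hDi.norm.mul_prod (hBi.const_mul C)
  have hm : Measurable (fun p : ℂ × ℂ => kernelDiff z₀ p.1 p.2 * dbar η p.1) := by
    have := measurable_kernel
    unfold kernelDiff
    fun_prop
  refine ((i1.add (i2.const_mul M)).add i3).mono' hm.aestronglyMeasurable ?_
  filter_upwards [Measure.quasiMeasurePreserving_snd.ae (ae_mem_support μ)] with ⟨z, w⟩ hw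
  simp only [Pi.add_apply] at hw ⊢
  have hd := decay_nonneg (norm_nonneg w)
  have hM0 : 0 ≤ M := (norm_nonneg _).trans (hM 0)
  have hBn : 0 ≤ B.indicator (fun _ => (1 : ℝ)) w := Set.indicator_nonneg (fun _ _ => zero_le_one) w
  by_cases hz : ‖z‖ ≤ R
  swap
  · have : dbar η z = 0 := image_eq_zero_of_notMem_tsupport fun h' => hz (by simpa using hR h')
    rw [this]
    simp only [mul_zero, norm_zero, zero_mul, zero_add, add_zero]
    positivity
  by_cases hwR : ‖w‖ ≤ R + 1
  · have hwB : w ∈ B := by simpa [hB] using hwR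
    have hzw : z - w ∈ Metric.ball (0 : ℂ) (2 * R + 2) := by
      rw [mem_ball_zero_iff]
      linarith [norm_sub_le z w]
    rw [Set.indicator_of_mem hwB, Set.indicator_of_mem hzw, norm_mul]
    have e1 : ‖kernel (z₀ - w)‖ ≤ C :=
      (hk w hw).trans (mul_le_of_le_one_right hC.le
        (inv_le_one_of_one_le₀ (by linarith [norm_nonneg w])))
    have e2 : ‖kernelDiff z₀ z w‖ ≤ ‖kernel (z - w)‖ + C :=
      (norm_sub_le _ _).trans (by gcongr)
    calc ‖kernelDiff z₀ z w‖ * ‖dbar η z‖ ≤ (‖kernel (z - w)‖ + C) * ‖dbar η z‖ := by gcongr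
      _ = 0 + ‖dbar η z‖ * ‖kernel (z - w)‖ + ‖dbar η z‖ * (C * 1) := by ring
      _ ≤ ‖dbar η z‖ * ((‖z₀‖ + R) * (R + 2) * C * decay ‖w‖) + M * (1 * ‖kernel (z - w)‖)
          + ‖dbar η z‖ * (C * 1) := by
          rw [one_mul]
          gcongr
          · positivity
          · exact hM z
  · rw [not_le] at hwR
    have hfar := norm_kernelDiff_far_le hC hR0 (hk w hw) (by rintro rfl; exact hz₀ hw) hz hwR
    rw [norm_mul, mul_comm]
    have : ‖dbar η z‖ * ‖kernelDiff z₀ z w‖ ≤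
        ‖dbar η z‖ * ((‖z₀‖ + R) * (R + 2) * C * decay ‖w‖) := by gcongr
    refine this.trans ?_
    rw [add_assoc]
    refine le_add_of_nonneg_right (by positivity)

/-- In the sense of distributions, `∂̄` of the Cauchy transform of `μ` is a multiple of `μ`. -/
lemma IsNice.integral_modTransform_mul_dbar (h : IsNice C₀ μ) {z₀ : ℂ} (hz₀ : z₀ ∉ μ.support)
    {η : ℂ → ℝ} (hη : ContDiff ℝ 1 η) (hs : HasCompactSupport η) :
    Integrable (fun z => modTransform μ z₀ z * dbar η z) ∧
      ∫ z, modTransform μ z₀ z * dbar η z = -(2 * Real.pi * ∫ w, η w ∂μ : ℝ) := by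
  have := h.isLocallyFiniteMeasure
  have hi := h.integrable_kernelDiff_mul_dbar hz₀ hη hs
  have e : (fun z => modTransform μ z₀ z * dbar η z) =
      fun z => ∫ w, kernelDiff z₀ z w * dbar η z ∂μ := by
    ext z
    rw [modTransform, integral_mul_const]
  rw [e]
  refine ⟨hi.integral_prod_left, ?_⟩
  rw [integral_integral_swap hi]
  -- The base-point term does not depend on `z` and drops out because `dbar η` has integral zero.
  have inner : ∀ w, ∫ z, kernelDiff z₀ z w * dbar η z = ((-(2 * Real.pi) * η w : ℝ) : ℂ) := by
    intro w
    have hD : Integrable (dbar η) :=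
      (continuous_dbar hη).integrable_of_hasCompactSupport (hasCompactSupport_dbar hs)
    simp only [kernelDiff, sub_mul]
    rw [integral_sub (integrable_kernel_mul_dbar hη hs w) (hD.const_mul _), integral_const_mul,
      integral_dbar hη hs, integral_kernel_mul_dbar hη hs]
    push_cast
    ring
  simp_rw [inner]
  rw [integral_complex_ofReal, integral_const_mul]
  push_cast
  ring

lemma IsNice.measurable_modTransform (h : IsNice C₀ μ) (z₀ : ℂ) :
    Measurable (modTransform μ z₀) := by
  have := h.isLocallyFiniteMeasure
  have hm : Measurable (fun p : ℂ × ℂ => kernelDiff z₀ p.1 p.2) := by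
    have := measurable_kernel
    unfold kernelDiff
    fun_prop
  exact hm.stronglyMeasurable.integral_prod_right.measurable

lemma IsNice.continuousAt_modTransform (h : IsNice C₀ μ) {z₀ z : ℂ} (hz₀ : z₀ ∉ μ.support)
    (hz : z ∉ μ.support) : ContinuousAt (modTransform μ z₀) z := by
  obtain ⟨C, hC, hk⟩ := exists_norm_kernel_sub_le hz
  obtain ⟨D, hD, hk₀⟩ := exists_norm_kernel_sub_le hz₀
  obtain ⟨d, hd, hball⟩ := Metric.isOpen_iff.1 Measure.isOpen_compl_support z hz
  refine continuousAt_of_dominated (bound := fun w => (‖z₀ - z‖ + d) * (2 * C) * D * decay ‖w‖)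
    (Eventually.of_forall fun x => (measurable_kernelDiff z₀ x).aestronglyMeasurable) ?_
    (h.integrable_decay_norm.const_mul _) ?_
  · filter_upwards [Metric.ball_mem_nhds z (half_pos hd)] with x hx
    filter_upwards [ae_mem_support μ] with w hw
    have hdw : d ≤ ‖z - w‖ := by
      by_contra hlt
      exact hball (by rwa [Metric.mem_ball', dist_eq_norm, ← not_le]) hw
    have hxz : ‖x - z‖ < d / 2 := by rwa [← dist_eq_norm]
    have hxw : ‖z - w‖ / 2 ≤ ‖x - w‖ := by
      have := norm_sub_le (x - w) (x - z)
      rw [show x - w - (x - z) = z - w by ring] at this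
      linarith
    have hk' : ‖kernel (x - w)‖ ≤ 2 * ‖kernel (z - w)‖ := by
      rw [norm_kernel, norm_kernel, ← div_eq_mul_inv, ← one_div,
        div_le_div_iff₀ (by linarith) (by linarith)]
      linarith
    rw [kernelDiff_eq (by rintro rfl; exact hz₀ hw)
      (by rintro rfl; simp only [sub_self, norm_zero] at hxw; linarith), norm_mul, norm_mul]
    calc ‖z₀ - x‖ * ‖kernel (x - w)‖ * ‖kernel (z₀ - w)‖
        ≤ (‖z₀ - z‖ + d) * (2 * (C * (1 + ‖w‖)⁻¹)) * (D * (1 + ‖w‖)⁻¹) := by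
          gcongr
          · have := norm_sub_le (z₀ - z) (x - z)
            rw [show z₀ - z - (x - z) = z₀ - x by ring] at this
            linarith
          · exact hk'.trans (by gcongr; exact hk w hw)
          · exact hk₀ w hw
      _ = (‖z₀ - z‖ + d) * (2 * C) * D * ((1 + ‖w‖) ^ 2)⁻¹ := by rw [sq, mul_inv]; ring
      _ ≤ _ := by gcongr; exact inv_sq_le_decay (norm_nonneg w)
  · filter_upwards [ae_mem_support μ] with w hw
    have : z - w ≠ 0 := sub_ne_zero.2 (by rintro rfl; exact hz hw)
    unfold kernelDiff kernel
    exact (continuousAt_const.div (continuousAt_id.sub continuousAt_const) this).sub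
      continuousAt_const

/-! ### From the two-valued transform to an indicator function -/

/-- `u` is, up to a null set, the indicator of a set whose distributional gradient is the measure
`μ` times the constant vector `b`. -/
structure IsHalfIndicator (μ : Measure ℂ) (b : ℂ) (u : ℂ → ℝ) : Prop where
  ne_zero : b ≠ 0
  measurable : Measurable u
  zero_or_one : ∀ z, u z = 0 ∨ u z = 1
  locallyConst : ∀ z ∉ μ.support, ∀ᶠ x in 𝓝 z, u x = u z
  integral_eq : ∀ η : ℂ → ℝ, ContDiff ℝ 1 η → HasCompactSupport η → ∀ v : ℂ,
    ∫ z, u z * fderiv ℝ η z v = -(inner ℝ b v) * ∫ w, η w ∂μ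

/-- The Cauchy transform of a reflectionless AD-regular measure is, up to scaling, an indicator
function with gradient in a constant direction. -/
lemma IsReflectionless.exists_isHalfIndicator (hrefl : IsReflectionless μ) (h : IsNice C₀ μ)
    (hAD : IsADRegular c₀ μ) (hμ : μ.support.Nonempty) :
    ∃ (b : ℂ) (u : ℂ → ℝ), IsHalfIndicator μ b u := by
  have := h.isLocallyFiniteMeasure
  obtain ⟨z₀, hz₀, α, hα⟩ := hrefl.exists_integral_symIntegrand_eq h hμ
  have hsq : ∀ z ∉ μ.support, modTransform μ z₀ z = 0 ∨ modTransform μ z₀ z = 2 * α := by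
    intro z hz
    have := h.modTransform_sq hz₀ hα hz
    rcases eq_or_ne (modTransform μ z₀ z) 0 with h0 | h0
    · exact Or.inl h0
    · exact Or.inr (mul_right_cancel₀ h0 (by rw [← this]; ring))
  -- If `α = 0`, the transform vanishes almost everywhere, so its `∂̄` would not see the mass of
  -- `μ`.
  have hα0 : α ≠ 0 := by
    rintro rfl
    obtain ⟨p, hp⟩ := hμ
    obtain ⟨η, hη, hs, -, hpos⟩ := exists_bump_integral_pos hp one_pos
    have h1 := (h.integral_modTransform_mul_dbar hz₀ hη hs).2
    have h2 : ∫ z, modTransform μ z₀ z * dbar η z = 0 := by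
      refine integral_eq_zero_of_ae ?_
      filter_upwards [hAD.ae_notMem_support] with z hz
      have : modTransform μ z₀ z = 0 := by simpa using hsq z hz
      simp [this]
    rw [h2, eq_comm, neg_eq_zero, Complex.ofReal_eq_zero] at h1
    have := Real.pi_pos
    have : 0 < 2 * Real.pi * ∫ w, η w ∂μ := by positivity
    linarith
  have h2α : 2 * α ≠ 0 := mul_ne_zero two_ne_zero hα0
  have hmeas := h.measurable_modTransform z₀
  set u : ℂ → ℝ := (modTransform μ z₀ ⁻¹' {0})ᶜ.indicator 1 with hu
  have hu01 : ∀ z, u z = 0 ∨ u z = 1 := fun z => by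
    rw [hu]
    by_cases hz : z ∈ (modTransform μ z₀ ⁻¹' {0})ᶜ <;> simp [hz]
  have huF : ∀ z ∉ μ.support, modTransform μ z₀ z = 2 * α * u z := by
    intro z hz
    rcases hsq z hz with h0 | h0
    · simp [hu, h0]
    · simp [hu, h0, hα0]
  -- `dbar` is twice `∂̄`, so the formula reads `∫ u dbar η = -(π / α) ∫ η dμ`; its real and
  -- imaginary parts give the two components of the gradient.
  refine ⟨Real.pi / α, u, ⟨div_ne_zero (by exact_mod_cast Real.pi_ne_zero) hα0, ?_, hu01, ?_, ?_⟩⟩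
  · exact measurable_one.indicator (hmeas (measurableSet_singleton 0)).compl
  · intro z hz
    have hopen : ∀ᶠ x in 𝓝 z, x ∉ μ.support := Measure.isOpen_compl_support.mem_nhds hz
    -- The radius `‖2α‖` is the gap between the two values, so continuity forces local constancy.
    have hnear := (h.continuousAt_modTransform hz₀ hz).eventually
      (Metric.ball_mem_nhds _ (norm_pos_iff.2 h2α))
    filter_upwards [hopen, hnear] with x hx hxF
    rw [dist_eq_norm, huF x hx, huF z hz, ← mul_sub, norm_mul] at hxF
    rcases hu01 x with h1 | h1 <;> rcases hu01 z with h2 | h2 <;> rw [h1, h2] at hxF ⊢ <;>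
      norm_num at hxF
  · intro η hη hs v
    obtain ⟨hint, heq⟩ := h.integral_modTransform_mul_dbar hz₀ hη hs
    have hae : (fun z => (u z : ℂ) * dbar η z) =ᵐ[volume]
        fun z => (2 * α)⁻¹ * (modTransform μ z₀ z * dbar η z) := by
      filter_upwards [hAD.ae_notMem_support] with z hz
      rw [huF z hz]
      field_simp
    have hi : Integrable (fun z => (u z : ℂ) * dbar η z) := (hint.const_mul _).congr hae.symm
    have hval : ∫ z, (u z : ℂ) * dbar η z = -(Real.pi / α) * ((∫ w, η w ∂μ : ℝ) : ℂ) := by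
      rw [integral_congr_ae hae, integral_const_mul, heq]
      push_cast
      field_simp
    have hre : ∀ z, ((u z : ℂ) * dbar η z).re = u z * fderiv ℝ η z 1 := fun z => by simp [dbar]
    have him : ∀ z, ((u z : ℂ) * dbar η z).im = u z * fderiv ℝ η z Complex.I := fun z => by
      simp [dbar]
    have i1 : Integrable (fun z => u z * fderiv ℝ η z 1) := by
      simp_rw [← hre]
      exact hi.re
    have i2 : Integrable (fun z => u z * fderiv ℝ η z Complex.I) := by
      simp_rw [← him]
      exact hi.im
    have v1 : ∫ z, u z * fderiv ℝ η z 1 = -(Real.pi / α : ℂ).re * ∫ w, η w ∂μ := by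
      simp_rw [← hre]
      refine (integral_re hi).trans ?_
      rw [hval]
      simp
    have v2 : ∫ z, u z * fderiv ℝ η z Complex.I = -(Real.pi / α : ℂ).im * ∫ w, η w ∂μ := by
      simp_rw [← him]
      refine (integral_im hi).trans ?_
      rw [hval]
      simp
    have hv : ∀ z, u z * fderiv ℝ η z v =
        v.re * (u z * fderiv ℝ η z 1) + v.im * (u z * fderiv ℝ η z Complex.I) := by
      intro z
      have e : v = v.re • (1 : ℂ) + v.im • Complex.I := by
        simp
      conv_lhs => rw [e, map_add, map_smul, map_smul]
      simp only [smul_eq_mul]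
      ring
    simp_rw [hv]
    rw [integral_add (i1.const_mul _) (i2.const_mul _), integral_const_mul, integral_const_mul, v1,
      v2, Complex.inner]
    simp only [Complex.mul_re, Complex.conj_re, Complex.conj_im]
    ring

/-! ### The support is a line orthogonal to `b` -/

namespace IsHalfIndicator

variable {b : ℂ} {u : ℂ → ℝ}

lemma norm_le_one (h : IsHalfIndicator μ b u) (z : ℂ) : ‖u z‖ ≤ 1 := by
  rcases h.zero_or_one z with h | h <;> simp [h]

lemma locallyIntegrable (h : IsHalfIndicator μ b u) : LocallyIntegrable u := by
  intro x
  refine ⟨Metric.ball x 1, Metric.ball_mem_nhds x one_pos, ?_⟩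
  exact Measure.integrableOn_of_bounded measure_ball_lt_top.ne h.measurable.aestronglyMeasurable
    (Eventually.of_forall h.norm_le_one)

/-- Outside the support, `u` is monotone in the direction `b`. -/
lemma le_of_inner_nonneg (h : IsHalfIndicator μ b u) {x y : ℂ} (hx : x ∉ μ.support)
    (hy : y ∉ μ.support) (hxy : 0 ≤ inner ℝ b (y - x)) : u x ≤ u y := by
  obtain ⟨r₁, hr₁, hb₁⟩ := Metric.eventually_nhds_iff_ball.1 (h.locallyConst x hx)
  obtain ⟨r₂, hr₂, hb₂⟩ := Metric.eventually_nhds_iff_ball.1 (h.locallyConst y hy)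
  set r := min r₁ r₂
  have hr0 : 0 < r := lt_min hr₁ hr₂
  -- The segment from `x` to `y` may cross the support, so monotonicity is proved for a
  -- mollification. Its radius is so small that near `x` and `y` only the constant values of `u` are
  -- averaged.
  let e : ContDiffBump (0 : ℂ) := ⟨r / 2, r, by linarith, by linarith⟩
  set G : ℂ → ℝ := convolution u e (ContinuousLinearMap.mul ℝ ℝ) volume
  have hGc : ∀ p : ℂ, (∀ t ∈ Metric.ball p r, u t = u p) → G p = u p * ∫ t, e t := by
    intro p hp
    rw [← integral_sub_left_eq_self (fun t => e t) volume p, ← integral_const_mul]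
    refine integral_congr_ae (Eventually.of_forall fun t => ?_)
    by_cases ht : t ∈ Metric.ball p r
    · simp [hp t ht]
    · have : e (p - t) = 0 := e.zero_of_le_dist (by
        rw [Metric.mem_ball', not_lt, dist_eq_norm] at ht
        rw [dist_zero_right]
        exact ht)
      simp [this]
  have hGx := hGc x fun t ht => hb₁ t (Metric.ball_subset_ball (min_le_left _ _) ht)
  have hGy := hGc y fun t ht => hb₂ t (Metric.ball_subset_ball (min_le_right _ _) ht)
  have hed : ContDiff ℝ 1 e := e.contDiff
  have hGd : ∀ p, HasFDerivAt G (convolution u (fderiv ℝ e)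
      ((ContinuousLinearMap.mul ℝ ℝ).precompR ℂ) volume p) p := fun p =>
    e.hasCompactSupport.hasFDerivAt_convolution_right _ h.locallyIntegrable hed p
  have hGv : ∀ p, 0 ≤ convolution u (fderiv ℝ e)
      ((ContinuousLinearMap.mul ℝ ℝ).precompR ℂ) volume p (y - x) := by
    intro p
    rw [convolution_precompR_apply _ h.locallyIntegrable (e.hasCompactSupport.fderiv ℝ)
      (hed.continuous_fderiv one_ne_zero)]
    have hη : ContDiff ℝ 1 (fun t => e (p - t)) := hed.comp (contDiff_const.sub contDiff_id)
    have hηs : HasCompactSupport (fun t => e (p - t)) :=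
      e.hasCompactSupport.comp_homeomorph (Homeomorph.subLeft p)
    have hfd : ∀ t, fderiv ℝ (fun t => e (p - t)) t (y - x) = -fderiv ℝ e (p - t) (y - x) := by
      intro t
      have h1 : HasFDerivAt (fun t : ℂ => p - t) (-ContinuousLinearMap.id ℝ ℂ) t :=
        (hasFDerivAt_id t).const_sub p
      have := ((hed.differentiable one_ne_zero (p - t)).hasFDerivAt.comp t h1).fderiv
      rw [show (fun t => e (p - t)) = e ∘ fun t => p - t from rfl, this]
      simp
    -- The derivative of the mollification along `y - x` is `⟨b, y - x⟩` times the integral of a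
    -- nonnegative bump against `μ`.
    have key := h.integral_eq _ hη hηs (y - x)
    simp_rw [hfd, mul_neg] at key
    rw [integral_neg, neg_mul, neg_inj] at key
    change 0 ≤ ∫ t, u t * fderiv ℝ e (p - t) (y - x)
    rw [key]
    exact mul_nonneg hxy (integral_nonneg fun t => e.nonneg)
  have hmono : Monotone fun t : ℝ => G (x + t • (y - x)) := by
    have hd : ∀ t : ℝ, HasDerivAt (fun t : ℝ => G (x + t • (y - x)))
        (convolution u (fderiv ℝ e) ((ContinuousLinearMap.mul ℝ ℝ).precompR ℂ) volume
          (x + t • (y - x)) (y - x)) t := by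
      intro t
      have h1 : HasDerivAt (fun t : ℝ => x + t • (y - x)) (y - x) t := by
        simpa using ((hasDerivAt_id t).smul_const (y - x)).const_add x
      exact (hGd _).comp_hasDerivAt t h1
    exact monotone_of_deriv_nonneg (fun t => (hd t).differentiableAt) fun t => by
      rw [(hd t).deriv]; exact hGv _
  have h01 := hmono zero_le_one
  simp only [zero_smul, add_zero, one_smul, add_sub_cancel] at h01
  rw [hGx, hGy] at h01
  exact le_of_mul_le_mul_right h01 e.integral_pos

/-- Near every point of the support, `u` takes both values. -/
lemma exists_near (h : IsHalfIndicator μ b u) [IsLocallyFiniteMeasure μ]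
    (hS : ∀ᵐ w ∂(volume : Measure ℂ), w ∉ μ.support) {p : ℂ}
    (hp : p ∈ μ.support) {ε : ℝ} (hε : 0 < ε) :
    (∃ x ∈ Metric.ball p ε, x ∉ μ.support ∧ u x = 0) ∧
      ∃ x ∈ Metric.ball p ε, x ∉ μ.support ∧ u x = 1 := by
  obtain ⟨η, hη, hs, hball, hpos⟩ := exists_bump_integral_pos hp hε
  have key := h.integral_eq η hη hs b
  have hb := h.ne_zero
  have hneg : ∫ z, u z * fderiv ℝ η z b ≠ 0 := by
    rw [key, real_inner_self_eq_norm_sq]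
    have : 0 < ‖b‖ := norm_pos_iff.2 hb
    have : 0 < ‖b‖ ^ 2 * ∫ w, η w ∂μ := by positivity
    linarith
  have hout : ∀ z ∉ Metric.ball p ε, fderiv ℝ η z b = 0 := fun z hz => by
    rw [image_eq_zero_of_notMem_tsupport (f := fderiv ℝ η)
      fun hmem => hz (hball (tsupport_fderiv_subset ℝ hmem))]
    rfl
  constructor
  -- If a value is missed, `u` is a.e. constant on the disc and its gradient there vanishes,
  -- contrary to the mass of `η` under `μ`.
  · by_contra! hcon
    refine hneg ?_
    rw [← integral_fderiv_eq_zero hη hs b]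
    refine integral_congr_ae ?_
    filter_upwards [hS] with z hz
    by_cases hzb : z ∈ Metric.ball p ε
    · rw [(h.zero_or_one z).resolve_left (hcon z hzb hz), one_mul]
    · rw [hout z hzb, mul_zero]
  · by_contra! hcon
    refine hneg (integral_eq_zero_of_ae ?_)
    filter_upwards [hS] with z hz
    by_cases hzb : z ∈ Metric.ball p ε
    · rw [(h.zero_or_one z).resolve_right (hcon z hzb hz), zero_mul]; rfl
    · rw [hout z hzb, mul_zero]; rfl

/-- Were `q` strictly ahead of `p` in the direction `b`, a value `1` near `p` and a value `0` near
`q` would contradict monotonicity. -/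
lemma inner_sub_nonpos (h : IsHalfIndicator μ b u) [IsLocallyFiniteMeasure μ]
    (hS : ∀ᵐ w ∂(volume : Measure ℂ), w ∉ μ.support) {p q : ℂ}
    (hp : p ∈ μ.support) (hq : q ∈ μ.support) : inner ℝ b (q - p) ≤ 0 := by
  by_contra! hpos
  -- Moving both points by `ε` changes the inner product by at most `2‖b‖ε`, less than `⟨b, q - p⟩`.
  set ε : ℝ := inner ℝ b (q - p) / (2 * (‖b‖ + 1))
  have hε0 : 0 < ε := by positivity
  obtain ⟨x, hxp, hx, hux⟩ := (h.exists_near hS hp hε0).2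
  obtain ⟨y, hyq, hy, huy⟩ := (h.exists_near hS hq hε0).1
  rw [Metric.mem_ball, dist_eq_norm] at hxp hyq
  have hle := h.le_of_inner_nonneg hx hy (by
    have e : y - x = (q - p) + (y - q) - (x - p) := by ring
    rw [e, inner_sub_right, inner_add_right]
    have h1 := (abs_le.1 (abs_real_inner_le_norm b (y - q))).1
    have h2 := (abs_le.1 (abs_real_inner_le_norm b (x - p))).2
    have h3 : ‖b‖ * ‖y - q‖ ≤ ‖b‖ * ε := by gcongr
    have h4 : ‖b‖ * ‖x - p‖ ≤ ‖b‖ * ε := by gcongr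
    have h5 : ε * (2 * (‖b‖ + 1)) = inner ℝ b (q - p) := div_mul_cancel₀ _ (by positivity)
    nlinarith)
  linarith

lemma inner_sub_eq_zero (h : IsHalfIndicator μ b u) [IsLocallyFiniteMeasure μ]
    (hS : ∀ᵐ w ∂(volume : Measure ℂ), w ∉ μ.support) {p q : ℂ}
    (hp : p ∈ μ.support) (hq : q ∈ μ.support) : inner ℝ b (q - p) = 0 := by
  refine le_antisymm (h.inner_sub_nonpos hS hp hq) ?_
  have := h.inner_sub_nonpos hS hq hp
  rw [← neg_sub, inner_neg_right] at this
  linarith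

/-- The support is invariant under translations orthogonal to `b`. -/
lemma add_mem_support (h : IsHalfIndicator μ b u) [IsLocallyFiniteMeasure μ]
    (hS : ∀ᵐ w ∂(volume : Measure ℂ), w ∉ μ.support) {p s : ℂ}
    (hp : p ∈ μ.support) (hs : inner ℝ b s = 0) : p + s ∈ μ.support := by
  by_contra hq
  have hopen : ∀ᶠ x in 𝓝 (p + s), x ∉ μ.support := Measure.isOpen_compl_support.mem_nhds hq
  obtain ⟨r, hr, hb⟩ := Metric.eventually_nhds_iff_ball.1 ((h.locallyConst _ hq).and hopen)
  obtain ⟨⟨x, hxp, hx, hux⟩, ⟨y, hyp, hy, huy⟩⟩ := h.exists_near hS hp hr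
  obtain ⟨hx1, hx2⟩ := hb (x + s) (by simpa using hxp)
  obtain ⟨hy1, hy2⟩ := hb (y + s) (by simpa using hyp)
  -- Orthogonal translation preserves `u` off the support, so both values near `p` would be carried
  -- into a disc where `u` is constant.
  have h1 := h.le_of_inner_nonneg hx2 hx (by rw [sub_add_cancel_left, inner_neg_right, hs, neg_zero])
  have h2 := h.le_of_inner_nonneg hy hy2 (by rw [add_sub_cancel_left, hs])
  linarith

end IsHalfIndicator

/-! ### The nearest point and the half-plane -/

lemma inner_eq_zero_of_norm_le {E : Type*} [NormedAddCommGroup E] [InnerProductSpace ℝ E]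
    {a s : E} (h : ∀ t : ℝ, ‖a‖ ≤ ‖a + t • s‖) : inner ℝ s a = 0 := by
  by_contra hne
  have hk : 0 < ‖s‖ ^ 2 + 1 := by positivity
  set k := ‖s‖ ^ 2 with hkd
  set c := inner ℝ s a with hc
  -- The minimizing parameter is `-c / k`; the denominator `k + 1` avoids a case split at `s = 0`
  -- and still lowers the norm.
  have ht := pow_le_pow_left₀ (norm_nonneg _) (h (-c / (k + 1))) 2
  rw [norm_add_sq_real, inner_smul_right, real_inner_comm, norm_smul, mul_pow, Real.norm_eq_abs,
    sq_abs, ← hc, ← hkd] at ht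
  have e : 2 * (-c / (k + 1) * c) + (-c / (k + 1)) ^ 2 * k = -(c ^ 2 * (k + 2) / (k + 1) ^ 2) := by
    field_simp
    ring
  have h1 : 0 < c ^ 2 * (k + 2) / (k + 1) ^ 2 := by positivity
  linarith

end CauchyTransform

end

theorem mainTheorem6 (μ : Measure ℂ) (C₀ c₀ : ℝ)
    (hgood : CauchyTransform.IsGood C₀ μ)
    (hAD : CauchyTransform.IsADRegular c₀ μ)
    (hrefl : CauchyTransform.IsReflectionless μ)
    (z z' : ℂ) (hz : z ∉ μ.support)
    (hz' : z' ∈ μ.support) (hclosest : ∀ w ∈ μ.support, dist z z' ≤ dist z w) :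
    μ.support ⊆ CauchyTransform.halfPlane z' ((z' - z) / (‖z' - z‖ : ℂ)) := by
  have := hgood.1.isLocallyFiniteMeasure
  have hS := hAD.ae_notMem_support
  obtain ⟨b, u, hu⟩ := hrefl.exists_isHalfIndicator hgood.1 hAD ⟨z', hz'⟩
  intro w hw
  have hb := hu.inner_sub_eq_zero hS hz' hw
  -- The whole line through `z'` and `w` lies in the support, so `z'` is nearest to `z` along it and
  -- the connecting vector is orthogonal to it.
  have horth : inner ℝ (w - z') (z' - z) = 0 := by
    refine CauchyTransform.inner_eq_zero_of_norm_le fun t => ?_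
    have := hclosest _ (hu.add_mem_support hS hz' (s := t • (w - z'))
      (by rw [inner_smul_right, hb, mul_zero]))
    rw [dist_comm, dist_comm z, dist_eq_norm, dist_eq_norm] at this
    rwa [add_sub_right_comm] at this
  have e : (z' - z) / (‖z' - z‖ : ℂ) = ‖z' - z‖⁻¹ • (z' - z) := by
    rw [Complex.real_smul, Complex.ofReal_inv, div_eq_inv_mul]
  change 0 ≤ inner ℝ (w - z') ((z' - z) / (‖z' - z‖ : ℂ))
  rw [e, inner_smul_right, horth, mul_zero]
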